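/- Let $E$ be a commutative unital C*-algebra. An $E$-C*-algebra is a C*-algebra $F$ with a bilinear map $E\times F\to F$, $(\alpha,x)\mapsto\alpha x$, making $F$ a unital $E$-module and satisfying $(\alpha x)y=x(\alpha y)=\alpha(xy)$, $(\alpha x)^*=\alpha^*x^*$, $\|\alpha x\|\le\|\alpha\|\,\|x\|$; a morphism is an $E$-linear $*$-homomorphism. Write $\check F$ for $E\times F$ with $(\alpha,x)(\beta,y)=(\alpha\beta,\alpha y+\beta x+xy)$, $(\alpha,x)^*=(\alpha^*,x^*)$, which is a unital $E$-C*-algebra with $E$ embedded by $\alpha\mapsto(\alpha,0)$; let $\pi^F:\check F\to E$, $(\alpha,x)\mapsto\alpha$, and $\check\varphi(\alpha,x)=(\alpha,\varphi x)$ for a morphism $\varphi$. Fix a group $T$ that is the union of an increasing sequence of finite subgroups $T_0=\{1\}\subset T_1\subset T_2\subset\dots$, and a map $f:T\times T\to\{u\in E: u \text{ unitary}\}$ with $f(1,1)=1$ and $f(r,s)f(rs,t)=f(r,st)f(s,t)$. For a unital C*-algebra $R$ containing $E$ as a central unital C*-subalgebra let $R_n$ be the $*$-algebra of operators $\sum_{t\in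 T_n}(X_t\otimes \mathrm{id})V_t$, $X_t\in R$, on the Hilbert module $R^{T_n}$, where $(V_t\xi)(s)=f(t,t^{-1}s)\,\xi(t^{-1}s)$ and $((x\otimes\mathrm{id})\xi)(s)=x\,\xi(s)$; $R_{n-1}\subset R_n$ canonically (extend the coefficients by $0$) and $E_n\subset R_n$. Fix $C_n\in E_n$ ($n\ge1$) commuting with $E_{n-1}$ such that $A_n=C_n^*C_n$ and $B_n=C_nC_n^*$ are projections with $A_n+B_n=1$. Let $R_\to$ be the algebraic inductive limit of $R_0\to R_1\to R_2\to\dots$ under $R_{n-1}\ni X\mapsto A_nX\in R_n$. The Murray--von Neumann classes of projections of $R_\to$ form a commutative semigroup with $[P]+[Q]=[P+Q]$ for $PQ=0$; its Grothendieck group is $K_0(R)$, which is functorial for unital $E$-linear $*$-homomorphisms (apply them to the coefficients $X_t$). For an arbitrary $E$-C*-algebra $F$ put $K_0(F)=\ker\big(K_0(\pi^F):K_0(\check F)\to K_0(E)\big)$, and let $K_0(\varphi):K_0(F)\to K_0(G)$ be the restriction of $K_0(\check\varphi)$. (For $F$ unital containing $E$ the two definitions agree up to canonical isomorphism.) **Theorem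 (Split exact theorem for $K_0$).** (a) Let $0\to F\xrightarrow{\varphi}G\overset{\psi}{\underset{\lambda}{\rightleftarrows}}H\to0$ be a split exact sequence of $E$-C*-algebras: $\varphi,\psi,\lambda$ are morphisms, $\varphi$ is injective, $\operatorname{im}\varphi=\ker\psi$, and $\psi\circ\lambda=\mathrm{id}_H$. Then $$0\to K_0(F)\xrightarrow{K_0(\varphi)}K_0(G)\overset{K_0(\psi)}{\underset{K_0(\lambda)}{\rightleftarrows}}K_0(H)\to0$$ is a split exact sequence of abelian groups. In particular $K_0(F)\times K_0(H)\to K_0(G)$, $(a,b)\mapsto K_0(\varphi)a+K_0(\lambda)b$, is a group isomorphism. (b) For every $E$-C*-algebra $F$, $K_0(\check F)\cong K_0(E)\times K_0(F)$ (with $K_0(\check F)$, $K_0(E)$ taken in either of the two senses). -/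

import Mathlib

open scoped Matrix

set_option linter.unusedSectionVars false

noncomputable section

namespace ProjK

/-! ### `E`-C*-algebras and split exact sequences -/

/-- `F` is an `E`-C*-algebra: a C*-algebra with an exterior multiplication by the commutative
unital C*-algebra `E` which is bilinear (the laws of `Module E F`, together with compatibility
with the complex scalars), associative and unital (also in `Module E F`), and compatible with
the product, the involution and the norm. -/
class ECStarAlgebra (E F : Type*) [CommCStarAlgebra E] [NonUnitalCStarAlgebra F]
    [Module E F] : Prop where
  complex_smul : ∀ (c : ℂ) (α : E) (x : F), (c • α) • x = c • (α • x)
  smul_mul : ∀ (α : E) (x y : F), (α • x) * y = α • (x * y)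
  mul_smul : ∀ (α : E) (x y : F), x * (α • y) = α • (x * y)
  star_smul : ∀ (α : E) (x : F), star (α • x) = star α • star x
  norm_smul_le : ∀ (α : E) (x : F), ‖α • x‖ ≤ ‖α‖ * ‖x‖

section
variable (E F : Type*) [CommCStarAlgebra E] [NonUnitalCStarAlgebra F] [Module E F]
  [ECStarAlgebra E F]

instance ECStarAlgebra.isScalarTower : IsScalarTower E F F :=
  ⟨fun α x y => ECStarAlgebra.smul_mul α x y⟩

instance ECStarAlgebra.smulCommClass : SMulCommClass E F F :=
  ⟨fun α x y => (ECStarAlgebra.mul_smul α x y).symm⟩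

instance ECStarAlgebra.starModule : StarModule E F :=
  ⟨fun α x => ECStarAlgebra.star_smul α x⟩

end

/-- `0 → A → B ⇄ C → 0` is split exact, with section `sec` of `g : B → C`. -/
def IsSplitExact {A B C : Type*} [Zero C] (f : A → B) (g : B → C) (sec : C → B) : Prop :=
  Function.Injective f ∧ Function.Exact f g ∧ Function.Surjective g ∧ ∀ c, g (sec c) = c

/-! ### The twisted group algebra of a finite group as an algebra of operators -/

/-- Schur `E`-functions for a group `S`. -/
structure IsSchurFunction {S E : Type*} [Group S] [CommRing E] [StarRing E] (g : S → S → E) :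
    Prop where
  mem_unitary : ∀ r s, g r s ∈ unitary E
  one_one : g 1 1 = 1
  cocycle : ∀ r s t, g r s * g (r * s) t = g r (s * t) * g s t

namespace IsSchurFunction
variable {S E : Type*} [Group S] [CommRing E] [StarRing E] {g : S → S → E}

theorem star_mul_self (hg : IsSchurFunction g) (r s : S) : star (g r s) * g r s = 1 :=
  Unitary.star_mul_self_of_mem (hg.mem_unitary r s)

theorem one_left (hg : IsSchurFunction g) (s : S) : g 1 s = 1 := by
  have h := hg.cocycle 1 1 s
  simp only [one_mul, hg.one_one] at h
  have h2 := hg.star_mul_self 1 s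
  calc g 1 s = (star (g 1 s) * g 1 s) * g 1 s := by rw [h2, one_mul]
    _ = star (g 1 s) * (g 1 s * g 1 s) := by ring
    _ = 1 := by rw [← h, h2]

theorem one_right (hg : IsSchurFunction g) (s : S) : g s 1 = 1 := by
  have h := hg.cocycle s 1 1
  simp only [mul_one, hg.one_one] at h
  have h2 := hg.star_mul_self s 1
  calc g s 1 = (star (g s 1) * g s 1) * g s 1 := by rw [h2, one_mul]
    _ = star (g s 1) * (g s 1 * g s 1) := by ring
    _ = 1 := by rw [h, h2]

theorem star_left_mul (hg : IsSchurFunction g) (u s : S) :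
    star (g u⁻¹ u) * g u s = star (g u⁻¹ (u * s)) := by
  have h := hg.cocycle u⁻¹ u s
  rw [inv_mul_cancel, hg.one_left, mul_one] at h
  rw [h, star_mul]
  calc star (g u s) * star (g u⁻¹ (u * s)) * g u s
      = (star (g u s) * g u s) * star (g u⁻¹ (u * s)) := by ring
    _ = _ := by rw [hg.star_mul_self, one_mul]

end IsSchurFunction

section twisted

variable {S E R : Type*} [Group S] [Fintype S] [DecidableEq S] [CommRing E] [StarRing E]
  [Ring R] [StarRing R] [Algebra E R] [StarModule E R]

/-- The operator `V t` on columns `ξ : S → R`, `(V t ξ) s = g(t, t⁻¹ s) ξ (t⁻¹ s)`, as a matrix. -/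
def opV (R : Type*) [Ring R] [Algebra E R] (g : S → S → E) (t : S) : Matrix S S R :=
  Matrix.of fun s s' => if s' = t⁻¹ * s then algebraMap E R (g t (t⁻¹ * s)) else 0

/-- The operator `∑ t, (X t ⊗ id) V t`, where `x ⊗ id` multiplies every entry of a column
by `x` from the left. -/
def ofCoeff (g : S → S → E) (X : S → R) : Matrix S S R :=
  ∑ t, Matrix.diagonal (fun _ => X t) * opV R g t

theorem ofCoeff_apply (g : S → S → E) (X : S → R) (s s' : S) :
    ofCoeff g X s s' = X (s * s'⁻¹) * algebraMap E R (g (s * s'⁻¹) s') := by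
  rw [ofCoeff, Matrix.sum_apply, Finset.sum_eq_single (s * s'⁻¹)]
  · simp [opV, Matrix.diagonal_mul]
  · intro t _ ht
    rw [Matrix.diagonal_mul, opV, Matrix.of_apply, if_neg, mul_zero]
    rintro rfl
    apply ht
    group
  · simp

/-- Coefficients of a product. -/
def conv (g : S → S → E) (X Y : S → R) (u : S) : R :=
  ∑ r, X r * Y (r⁻¹ * u) * algebraMap E R (g r (r⁻¹ * u))

theorem ofCoeff_mul {g : S → S → E} (hg : IsSchurFunction g) (X Y : S → R) :
    ofCoeff g X * ofCoeff g Y = ofCoeff g (conv g X Y) := by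
  ext s s''
  rw [Matrix.mul_apply, ofCoeff_apply, conv, Finset.sum_mul]
  refine Fintype.sum_equiv ((Equiv.inv S).trans (Equiv.mulLeft s)) _ _ fun s' => ?_
  simp only [ofCoeff_apply, Equiv.trans_apply, Equiv.inv_apply, Equiv.coe_mulLeft]
  have h := hg.cocycle (s * s'⁻¹) (s' * s''⁻¹) s''
  have e1 : (s * s'⁻¹)⁻¹ * (s * s''⁻¹) = s' * s''⁻¹ := by group
  have e2 : s * s'⁻¹ * (s' * s''⁻¹) = s * s''⁻¹ := by group
  have e3 : s' * s''⁻¹ * s'' = s' := by group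
  rw [e2, e3] at h
  rw [e1, mul_assoc (X _ * Y _), ← map_mul, h, map_mul]
  have c := Algebra.commutes (g (s * s'⁻¹) s') (Y (s' * s''⁻¹))
  rw [mul_assoc, ← mul_assoc (algebraMap E R _) (Y _), c]
  simp only [mul_assoc]

/-- Coefficients of an adjoint. -/
def convStar (g : S → S → E) (X : S → R) (u : S) : R :=
  star (X u⁻¹) * algebraMap E R (star (g u⁻¹ u))

theorem ofCoeff_star {g : S → S → E} (hg : IsSchurFunction g) (X : S → R) :
    star (ofCoeff g X) = ofCoeff g (convStar g X) := by
  ext s s'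
  rw [Matrix.star_apply, ofCoeff_apply, ofCoeff_apply, convStar, mul_assoc, ← map_mul,
    hg.star_left_mul, star_mul]
  have e1 : (s * s'⁻¹)⁻¹ = s' * s⁻¹ := by group
  have e2 : s * s'⁻¹ * s' = s := by group
  rw [e1, e2, ← algebraMap_star_comm]
  exact Algebra.commutes _ _

theorem ofCoeff_single {g : S → S → E} (hg : IsSchurFunction g) (e : E) :
    ofCoeff g (Pi.single 1 (algebraMap E R e)) = algebraMap E (Matrix S S R) e := by
  ext s s'
  rw [ofCoeff_apply, Matrix.algebraMap_matrix_apply]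
  by_cases h : s = s'
  · subst h
    simp [hg.one_left]
  · have : s * s'⁻¹ ≠ 1 := fun h' => h (mul_inv_eq_one.mp h')
    simp [h, this]

theorem ofCoeff_add (g : S → S → E) (X Y : S → R) :
    ofCoeff g X + ofCoeff g Y = ofCoeff g (X + Y) := by
  ext s s'
  simp [ofCoeff_apply, add_mul]

/-- The algebra of all operators `∑ t, (X t ⊗ id) V t`; the adjointable operators on the
Hilbert module of columns `S → R` are the matrices acting from the left, and the
adjoint is the conjugate transpose. -/
def twistedAlgebra (R : Type*) [Ring R] [StarRing R] [Algebra E R] [StarModule E R]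
    {g : S → S → E} (hg : IsSchurFunction g) : StarSubalgebra E (Matrix S S R) where
  carrier := Set.range (ofCoeff g)
  mul_mem' := by
    rintro _ _ ⟨X, rfl⟩ ⟨Y, rfl⟩
    exact ⟨_, (ofCoeff_mul hg X Y).symm⟩
  add_mem' := by
    rintro _ _ ⟨X, rfl⟩ ⟨Y, rfl⟩
    exact ⟨_, (ofCoeff_add g X Y).symm⟩
  algebraMap_mem' e := ⟨_, ofCoeff_single hg e⟩
  star_mem' := by
    rintro _ ⟨X, rfl⟩
    exact ⟨_, (ofCoeff_star hg X).symm⟩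

/-- The coefficients `X t` of `∑ t, (X t ⊗ id) V t`, read off from the column at `1`. -/
def coeff (M : Matrix S S R) (t : S) : R := M t 1

theorem coeff_ofCoeff {g : S → S → E} (hg : IsSchurFunction g) (X : S → R) :
    coeff (ofCoeff g X) = X := by
  ext t
  simp [coeff, ofCoeff_apply, hg.one_right]

theorem ofCoeff_coeff {g : S → S → E} (hg : IsSchurFunction g) (M : twistedAlgebra R hg) :
    ofCoeff g (coeff (M : Matrix S S R)) = M := by
  obtain ⟨_, X, rfl⟩ := M
  rw [coeff_ofCoeff hg]

/-- Change of coefficients `∑ t, (X t ⊗ id) V t ↦ ∑ t, (φ (X t) ⊗ id) V t`. -/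
def mapCoeff {R' : Type*} [Ring R'] [StarRing R'] [Algebra E R'] [StarModule E R']
    {g : S → S → E} (hg : IsSchurFunction g) (φ : R →⋆ₐ[E] R') :
    twistedAlgebra R hg →⋆ₐ[E] twistedAlgebra R' hg where
  toFun M := ⟨(M : Matrix S S R).map φ, by
    obtain ⟨_, X, rfl⟩ := M
    refine ⟨fun t => φ (X t), ?_⟩
    ext s s'
    simp [ofCoeff_apply, AlgHomClass.commutes]⟩
  map_one' := by ext s s'; simp [Matrix.one_apply, apply_ite φ]
  map_mul' M N := by ext s s'; simp [Matrix.mul_apply]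
  map_zero' := by ext s s'; simp
  map_add' M N := by ext s s'; simp
  commutes' e := by
    ext s s'; simp [Matrix.algebraMap_matrix_apply, apply_ite φ, AlgHomClass.commutes]
  map_star' M := by ext s s'; simp [Matrix.star_apply, map_star]

theorem mapCoeff_apply {R' : Type*} [Ring R'] [StarRing R'] [Algebra E R'] [StarModule E R']
    {g : S → S → E} (hg : IsSchurFunction g) (φ : R →⋆ₐ[E] R') (M : twistedAlgebra R hg)
    (s s' : S) :
    (mapCoeff hg φ M : Matrix S S R') s s' = φ ((M : Matrix S S R) s s') := rfl

section incl

variable {S' : Type*} [Group S'] [Fintype S'] [DecidableEq S']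

/-- Extension of coefficients by `0`. -/
def extCoeff (ι : S →* S') (X : S → R) : S' → R := Function.extend ι X 0

theorem extCoeff_apply {ι : S →* S'} (hι : Function.Injective ι) (X : S → R) (a : S) :
    extCoeff ι X (ι a) = X a := hι.extend_apply _ _ _

theorem extCoeff_of_notMem {ι : S →* S'} (X : S → R) {u : S'} (h : ¬ ∃ a, ι a = u) :
    extCoeff ι X u = 0 := Function.extend_apply' _ _ _ h

theorem extCoeff_add {ι : S →* S'} (hι : Function.Injective ι) (X Y : S → R) :
    extCoeff ι (X + Y) = extCoeff ι X + extCoeff ι Y := by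
  ext u
  by_cases h : ∃ a, ι a = u
  · obtain ⟨a, rfl⟩ := h
    simp [extCoeff_apply hι]
  · simp [extCoeff_of_notMem _ h]

theorem extCoeff_single {ι : S →* S'} (hι : Function.Injective ι) (x : R) :
    extCoeff ι (Pi.single 1 x) = Pi.single 1 x := by
  ext u
  by_cases h : ∃ a, ι a = u
  · obtain ⟨a, rfl⟩ := h
    by_cases ha : a = 1
    · subst ha
      rw [extCoeff_apply hι, map_one, Pi.single_eq_same, Pi.single_eq_same]
    · rw [extCoeff_apply hι, Pi.single_eq_of_ne ha, Pi.single_eq_of_ne]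
      exact fun h => ha (hι (h.trans (map_one ι).symm))
  · rw [extCoeff_of_notMem _ h, Pi.single_eq_of_ne]
    rintro rfl
    exact h ⟨1, map_one ι⟩

theorem extCoeff_conv {g : S → S → E} {g' : S' → S' → E} {ι : S →* S'}
    (hι : Function.Injective ι) (hgg : ∀ r s, g' (ι r) (ι s) = g r s) (X Y : S → R) :
    conv g' (extCoeff ι X) (extCoeff ι Y) = extCoeff ι (conv g X Y) := by
  ext u
  by_cases h : ∃ a, ι a = u
  · obtain ⟨a, rfl⟩ := h
    rw [extCoeff_apply hι, conv, conv]
    symm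
    refine Finset.sum_of_injOn ι hι.injOn (fun _ _ => by simp) ?_ ?_
    · intro r _ hr
      rw [extCoeff_of_notMem, zero_mul, zero_mul]
      rintro ⟨b, rfl⟩
      exact hr ⟨b, by simp, rfl⟩
    · intro r _
      rw [← map_inv, ← map_mul, extCoeff_apply hι, extCoeff_apply hι, hgg]
  · rw [extCoeff_of_notMem _ h, conv]
    refine Finset.sum_eq_zero fun r _ => ?_
    by_cases hr : ∃ b, ι b = r
    · obtain ⟨b, rfl⟩ := hr
      rw [extCoeff_of_notMem Y, mul_zero, zero_mul]
      rintro ⟨c, hc⟩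
      exact h ⟨b * c, by rw [map_mul, hc, mul_inv_cancel_left]⟩
    · rw [extCoeff_of_notMem X hr, zero_mul, zero_mul]

theorem extCoeff_convStar {g : S → S → E} {g' : S' → S' → E} {ι : S →* S'}
    (hι : Function.Injective ι) (hgg : ∀ r s, g' (ι r) (ι s) = g r s) (X : S → R) :
    convStar g' (extCoeff ι X) = extCoeff ι (convStar g X) := by
  ext u
  by_cases h : ∃ a, ι a = u
  · obtain ⟨a, rfl⟩ := h
    rw [extCoeff_apply hι, convStar, convStar, ← map_inv, extCoeff_apply hι, hgg]
  · rw [extCoeff_of_notMem _ h, convStar, extCoeff_of_notMem X, star_zero, zero_mul]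
    rintro ⟨b, hb⟩
    exact h ⟨b⁻¹, by rw [map_inv, hb, inv_inv]⟩

/-- The canonical inclusion of the twisted algebra of a subgroup,
`∑ t, (X t ⊗ id) V t ↦ ∑ t, (X t ⊗ id) V t`; coefficients are extended by `0`. -/
def incl {g : S → S → E} (hg : IsSchurFunction g) {g' : S' → S' → E} (hg' : IsSchurFunction g')
    (ι : S →* S') (hι : Function.Injective ι) (hgg : ∀ r s, g' (ι r) (ι s) = g r s) :
    twistedAlgebra R hg →⋆ₐ[E] twistedAlgebra R hg' where
  toFun M := ⟨ofCoeff g' (extCoeff ι (coeff (M : Matrix S S R))), ⟨_, rfl⟩⟩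
  map_one' := by
    apply Subtype.ext
    change ofCoeff g' (extCoeff ι (coeff (1 : Matrix S S R))) = 1
    rw [← map_one (algebraMap E (Matrix S S R)), ← ofCoeff_single hg, coeff_ofCoeff hg,
      extCoeff_single hι, ofCoeff_single hg', map_one]
  map_mul' := by
    rintro ⟨_, X, rfl⟩ ⟨_, Y, rfl⟩
    apply Subtype.ext
    change ofCoeff g' (extCoeff ι (coeff (ofCoeff g X * ofCoeff g Y))) =
      ofCoeff g' (extCoeff ι (coeff (ofCoeff g X))) *
        ofCoeff g' (extCoeff ι (coeff (ofCoeff g Y)))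
    rw [ofCoeff_mul hg, ofCoeff_mul hg', coeff_ofCoeff hg, coeff_ofCoeff hg, coeff_ofCoeff hg,
      extCoeff_conv hι hgg]
  map_zero' := by
    apply Subtype.ext
    change ofCoeff g' (extCoeff ι (coeff (0 : Matrix S S R))) = 0
    rw [← map_zero (algebraMap E (Matrix S S R)), ← ofCoeff_single hg, coeff_ofCoeff hg,
      extCoeff_single hι, ofCoeff_single hg', map_zero]
  map_add' := by
    rintro ⟨_, X, rfl⟩ ⟨_, Y, rfl⟩
    apply Subtype.ext
    change ofCoeff g' (extCoeff ι (coeff (ofCoeff g X + ofCoeff g Y))) =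
      ofCoeff g' (extCoeff ι (coeff (ofCoeff g X))) +
        ofCoeff g' (extCoeff ι (coeff (ofCoeff g Y)))
    rw [ofCoeff_add, ofCoeff_add, coeff_ofCoeff hg, coeff_ofCoeff hg, coeff_ofCoeff hg,
      extCoeff_add hι]
  commutes' e := by
    apply Subtype.ext
    change ofCoeff g' (extCoeff ι (coeff (algebraMap E (Matrix S S R) e))) =
      algebraMap E (Matrix S' S' R) e
    rw [← ofCoeff_single hg, coeff_ofCoeff hg, extCoeff_single hι, ofCoeff_single hg']
  map_star' := by
    rintro ⟨_, X, rfl⟩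
    apply Subtype.ext
    change ofCoeff g' (extCoeff ι (coeff (star (ofCoeff g X)))) =
      star (ofCoeff g' (extCoeff ι (coeff (ofCoeff g X))))
    rw [ofCoeff_star hg, ofCoeff_star hg', coeff_ofCoeff hg, coeff_ofCoeff hg,
      extCoeff_convStar hι hgg]

theorem incl_mk {g : S → S → E} (hg : IsSchurFunction g) {g' : S' → S' → E}
    (hg' : IsSchurFunction g') (ι : S →* S') (hι : Function.Injective ι)
    (hgg : ∀ r s, g' (ι r) (ι s) = g r s) (X : S → R) :
    (incl hg hg' ι hι hgg ⟨ofCoeff g X, ⟨X, rfl⟩⟩ : Matrix S' S' R) =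
      ofCoeff g' (extCoeff ι X) := by
  change ofCoeff g' (extCoeff ι (coeff (ofCoeff g X))) = _
  rw [coeff_ofCoeff hg]

theorem mapCoeff_incl {R' : Type*} [Ring R'] [StarRing R'] [Algebra E R'] [StarModule E R']
    {g : S → S → E} (hg : IsSchurFunction g) {g' : S' → S' → E}
    (hg' : IsSchurFunction g') (ι : S →* S') (hι : Function.Injective ι)
    (hgg : ∀ r s, g' (ι r) (ι s) = g r s) (φ : R →⋆ₐ[E] R') (M : twistedAlgebra R hg) :
    mapCoeff hg' φ (incl hg hg' ι hι hgg M) = incl hg hg' ι hι hgg (mapCoeff hg φ M) := by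
  have key : ∀ u, φ (extCoeff ι (coeff (M : Matrix S S R)) u) =
      extCoeff ι (coeff (mapCoeff hg φ M : Matrix S S R')) u := by
    intro u
    by_cases h : ∃ a, ι a = u
    · obtain ⟨a, rfl⟩ := h
      rw [extCoeff_apply hι, extCoeff_apply hι]
      rfl
    · rw [extCoeff_of_notMem _ h, extCoeff_of_notMem _ h, map_zero]
  apply Subtype.ext
  ext s s'
  rw [mapCoeff_apply]
  change φ (ofCoeff g' (extCoeff ι (coeff (M : Matrix S S R))) s s') =
    ofCoeff g' (extCoeff ι (coeff (mapCoeff hg φ M : Matrix S S R'))) s s'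
  rw [ofCoeff_apply, ofCoeff_apply, map_mul, key, AlgHomClass.commutes]

theorem ofCoeff_extCoeff (g' : S' → S' → E) {ι : S →* S'} (hι : Function.Injective ι)
    (X : S → R) : ofCoeff g' (extCoeff ι X) =
      ∑ u, Matrix.diagonal (fun _ => X u) * opV R g' (ι u) := by
  rw [ofCoeff]
  symm
  refine Finset.sum_of_injOn ι hι.injOn (fun _ _ => by simp) ?_ ?_
  · intro r _ hr
    rw [extCoeff_of_notMem]
    · simp
    · rintro ⟨b, rfl⟩
      exact hr ⟨b, by simp, rfl⟩
  · intro r _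
    rw [extCoeff_apply hι]

theorem opV_map (g' : S' → S' → E) (t : S') :
    (opV E g' t).map (algebraMap E R) = opV R g' t := by
  ext s s'
  simp only [opV, Matrix.map_apply, Matrix.of_apply]
  split_ifs <;> simp

/-- An element with coefficients in `E` which commutes with the twisted algebra over `E` of a
subgroup also commutes with the twisted algebra over `R` of that subgroup. -/
theorem commute_incl {g : S → S → E} (hg : IsSchurFunction g) {g' : S' → S' → E}
    (hg' : IsSchurFunction g') (ι : S →* S') (hι : Function.Injective ι)
    (hgg : ∀ r s, g' (ι r) (ι s) = g r s) (c : twistedAlgebra E hg')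
    (hc : ∀ X : twistedAlgebra E hg, c * incl hg hg' ι hι hgg X = incl hg hg' ι hι hgg X * c)
    (X : twistedAlgebra R hg) :
    mapCoeff hg' (StarAlgHom.ofId E R) c * incl hg hg' ι hι hgg X =
      incl hg hg' ι hι hgg X * mapCoeff hg' (StarAlgHom.ofId E R) c := by
  have h1 : ∀ u : S, (c : Matrix S' S' E) * opV E g' (ι u) = opV E g' (ι u) * c := by
    intro u
    have h := congrArg Subtype.val (hc ⟨ofCoeff g (Pi.single u 1), ⟨_, rfl⟩⟩)
    simp only [MulMemClass.coe_mul] at h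
    rw [incl_mk, ofCoeff_extCoeff g' hι, Finset.sum_eq_single u] at h
    · simpa using h
    · intro v _ hv
      simp [Pi.single_eq_of_ne hv]
    · simp
  have h2 : ∀ u : S, (c : Matrix S' S' E).map (algebraMap E R) * opV R g' (ι u) =
      opV R g' (ι u) * (c : Matrix S' S' E).map (algebraMap E R) := by
    intro u
    rw [← opV_map, ← Matrix.map_mul, h1, Matrix.map_mul]
  have h3 : ∀ x : R, (c : Matrix S' S' E).map (algebraMap E R) * Matrix.diagonal (fun _ => x) =
      Matrix.diagonal (fun _ => x) * (c : Matrix S' S' E).map (algebraMap E R) := by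
    intro x
    ext s s'
    rw [Matrix.mul_diagonal, Matrix.diagonal_mul, Matrix.map_apply]
    exact Algebra.commutes _ _
  obtain ⟨_, X, rfl⟩ := X
  apply Subtype.ext
  simp only [MulMemClass.coe_mul]
  rw [incl_mk, ofCoeff_extCoeff g' hι]
  change (c : Matrix S' S' E).map (algebraMap E R) * _ =
    _ * (c : Matrix S' S' E).map (algebraMap E R)
  rw [Finset.mul_sum, Finset.sum_mul]
  refine Finset.sum_congr rfl fun u _ => ?_
  rw [← mul_assoc, h3, mul_assoc, h2, mul_assoc]

end incl

end twisted

/-! ### Murray - von Neumann equivalence and the Grothendieck group of projections -/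

section MvN

variable {A : Type*} [NonUnitalRing A] [StarRing A]

/-- Murray - von Neumann equivalence. -/
def MvNRel (p q : A) : Prop := ∃ x : A, star x * x = p ∧ x * star x = q

/-- The projections `p = p* = p²` of `A`. -/
def Proj (A : Type*) [NonUnitalRing A] [StarRing A] : Type _ := {p : A // IsStarProjection p}

/-- Equivalent projections are related by a partial isometry. -/
theorem MvNRel.exists_partial {p q : A} (hp : IsStarProjection p) (hq : IsStarProjection q)
    (h : MvNRel p q) : ∃ x : A, star x * x = p ∧ x * star x = q ∧ x * p = x ∧ q * x = x := by
  obtain ⟨x, h1, h2⟩ := h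
  have hpp : p * p = p := hp.isIdempotentElem
  have hqq : q * q = q := hq.isIdempotentElem
  have hps : star p = p := hp.isSelfAdjoint
  have e : q * x = x * p := by rw [← h1, ← h2, mul_assoc]
  refine ⟨x * p, ?_, ?_, ?_, ?_⟩
  · rw [star_mul, hps, mul_assoc, ← mul_assoc (star x), h1, hpp, hpp]
  · rw [star_mul, hps, mul_assoc, ← mul_assoc p, hpp, ← mul_assoc, ← e, mul_assoc, h2, hqq]
  · rw [mul_assoc, hpp]
  · rw [← mul_assoc, e, mul_assoc, hpp]

theorem MvNRel.refl {p : A} (hp : IsStarProjection p) : MvNRel p p := by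
  refine ⟨p, ?_, ?_⟩ <;> rw [show star p = p from hp.isSelfAdjoint] <;> exact hp.isIdempotentElem

theorem MvNRel.symm {p q : A} (h : MvNRel p q) : MvNRel q p := by
  obtain ⟨x, h1, h2⟩ := h
  exact ⟨star x, by rw [star_star, h2], by rw [star_star, h1]⟩

theorem MvNRel.trans {p q r : A} (hp : IsStarProjection p) (hq : IsStarProjection q)
    (hr : IsStarProjection r) (h : MvNRel p q) (h' : MvNRel q r) : MvNRel p r := by
  obtain ⟨x, h1, h2, h3, h4⟩ := h.exists_partial hp hq
  obtain ⟨y, h5, h6, h7, h8⟩ := h'.exists_partial hq hr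
  refine ⟨y * x, ?_, ?_⟩
  · rw [star_mul, mul_assoc, ← mul_assoc (star y), h5, h4, h1]
  · rw [star_mul, mul_assoc, ← mul_assoc x, h2, ← mul_assoc, h7, h6]

/-- Sums of orthogonal equivalent projections are equivalent. -/
theorem MvNRel.add {p p' q q' : A} (hp : IsStarProjection p) (hp' : IsStarProjection p')
    (hq : IsStarProjection q) (hq' : IsStarProjection q')
    (h : MvNRel p p') (h' : MvNRel q q') (ho : p * q = 0) (ho' : p' * q' = 0) :
    MvNRel (p + q) (p' + q') := by
  obtain ⟨x, h1, h2, h3, h4⟩ := h.exists_partial hp hp'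
  obtain ⟨y, h5, h6, h7, h8⟩ := h'.exists_partial hq hq'
  have xs : star x = star x * p' := by
    conv_lhs => rw [← h4, star_mul, show star p' = p' from hp'.isSelfAdjoint]
  have ys : star y = q * star y := by
    conv_lhs => rw [← h7, star_mul, show star q = q from hq.isSelfAdjoint]
  have e1 : star x * y = 0 := by
    rw [xs, ← h8, mul_assoc, ← mul_assoc p', ho', zero_mul, mul_zero]
  have e2 : x * star y = 0 := by
    rw [ys, ← h3, mul_assoc, ← mul_assoc p, ho, zero_mul, mul_zero]
  have e1' : star y * x = 0 := by
    have := congrArg star e1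
    rwa [star_mul, star_star, star_zero] at this
  have e2' : y * star x = 0 := by
    have := congrArg star e2
    rwa [star_mul, star_star, star_zero] at this
  refine ⟨x + y, ?_, ?_⟩
  · rw [star_add, add_mul, mul_add, mul_add, h1, h5, e1, e1', add_zero, zero_add]
  · rw [star_add, add_mul, mul_add, mul_add, h2, h6, e2, e2', add_zero, zero_add]

theorem orth_symm {p q : A} (hp : IsStarProjection p) (hq : IsStarProjection q)
    (h : p * q = 0) : q * p = 0 := by
  have := congrArg star h
  rwa [star_mul, star_zero, show star p = p from hp.isSelfAdjoint,
    show star q = q from hq.isSelfAdjoint] at this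

theorem orth_add {p q : A} (hp : IsStarProjection p) (hq : IsStarProjection q)
    (h : p * q = 0) : IsStarProjection (p + q) := by
  have h' := orth_symm hp hq h
  refine ⟨?_, hp.isSelfAdjoint.add hq.isSelfAdjoint⟩
  rw [IsIdempotentElem, add_mul, mul_add, mul_add, h, h', hp.isIdempotentElem.eq,
    hq.isIdempotentElem.eq, add_zero, zero_add]

instance Proj.setoid (A : Type*) [NonUnitalRing A] [StarRing A] : Setoid (Proj A) where
  r p q := MvNRel p.1 q.1
  iseqv := ⟨fun p => MvNRel.refl p.2, fun h => h.symm, fun {p q r} h h' => h.trans p.2 q.2 r.2 h'⟩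

/-- The set of Murray - von Neumann classes of projections of `A`. -/
def MvN (A : Type*) [NonUnitalRing A] [StarRing A] : Type _ := Quotient (Proj.setoid A)

/-- The class of a projection. -/
def MvN.mk (p : A) (hp : IsStarProjection p) : MvN A := Quotient.mk (Proj.setoid A) ⟨p, hp⟩

theorem MvN.mk_eq {p q : A} {hp : IsStarProjection p} {hq : IsStarProjection q} :
    MvN.mk p hp = MvN.mk q hq ↔ MvNRel p q :=
  Quotient.eq (r := Proj.setoid A)

theorem MvN.exists_mk (a : MvN A) : ∃ p hp, a = MvN.mk (A := A) p hp := by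
  obtain ⟨⟨p, hp⟩, rfl⟩ := Quotient.exists_rep a
  exact ⟨p, hp, rfl⟩

/-- Any two projections can be made orthogonal within their equivalence classes. -/
class OrthCopies (A : Type*) [NonUnitalRing A] [StarRing A] : Prop where
  exists_orth : ∀ p q : A, IsStarProjection p → IsStarProjection q →
    ∃ q', IsStarProjection q' ∧ MvNRel q q' ∧ p * q' = 0

variable [OrthCopies A]

theorem MvN.exists_add (a b : MvN A) : ∃ (p q : A) (hp : IsStarProjection p)
    (hq : IsStarProjection q), p * q = 0 ∧ a = MvN.mk p hp ∧ b = MvN.mk q hq := by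
  obtain ⟨p, hp, rfl⟩ := a.exists_mk
  obtain ⟨q, hq, rfl⟩ := b.exists_mk
  obtain ⟨q', hq', h, ho⟩ := OrthCopies.exists_orth p q hp hq
  exact ⟨p, q', hp, hq', ho, rfl, MvN.mk_eq.2 h⟩

/-- The sum of two classes is the class of `p + q`, for any orthogonal representatives
`p`, `q`. -/
instance : Add (MvN A) where
  add a b := MvN.mk ((MvN.exists_add a b).choose + (MvN.exists_add a b).choose_spec.choose)
    (orth_add (MvN.exists_add a b).choose_spec.choose_spec.choose
      (MvN.exists_add a b).choose_spec.choose_spec.choose_spec.choose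
      (MvN.exists_add a b).choose_spec.choose_spec.choose_spec.choose_spec.1)

theorem MvN.add_mk {p q : A} (hp : IsStarProjection p) (hq : IsStarProjection q)
    (ho : p * q = 0) : MvN.mk p hp + MvN.mk q hq = MvN.mk (p + q) (orth_add hp hq ho) := by
  obtain ⟨hp', hq', ho', h1, h2⟩ :=
    (MvN.exists_add (MvN.mk p hp) (MvN.mk q hq)).choose_spec.choose_spec
  exact MvN.mk_eq.2 (MvNRel.add hp' hp hq' hq (MvN.mk_eq.1 h1).symm (MvN.mk_eq.1 h2).symm ho' ho)

instance : Zero (MvN A) := ⟨MvN.mk 0 (IsStarProjection.zero A)⟩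

theorem MvN.zero_def : (0 : MvN A) = MvN.mk 0 (IsStarProjection.zero A) := rfl

instance : AddCommMonoid (MvN A) where
  add_assoc a b c := by
    obtain ⟨p, q, hp, hq, ho, rfl, rfl⟩ := MvN.exists_add a b
    obtain ⟨r₀, hr₀, rfl⟩ := c.exists_mk
    obtain ⟨r, hr, h, hor⟩ := OrthCopies.exists_orth (p + q) r₀ (orth_add hp hq ho) hr₀
    rw [show MvN.mk r₀ hr₀ = MvN.mk r hr from MvN.mk_eq.2 h]
    have hpr : p * r = 0 := by
      have := congrArg (p * ·) hor
      simpa [add_mul, mul_add, ← mul_assoc, ho, hp.isIdempotentElem.eq] using this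
    have hqr : q * r = 0 := by
      simpa [add_mul, hpr] using hor
    rw [MvN.add_mk hp hq ho, MvN.add_mk _ hr hor, MvN.add_mk hq hr hqr,
      MvN.add_mk hp _ (by rw [mul_add, ho, hpr, add_zero])]
    simp only [add_assoc]
  add_comm a b := by
    obtain ⟨p, q, hp, hq, ho, rfl, rfl⟩ := MvN.exists_add a b
    rw [MvN.add_mk hp hq ho, MvN.add_mk hq hp (orth_symm hp hq ho)]
    simp only [add_comm]
  zero_add a := by
    obtain ⟨p, hp, rfl⟩ := a.exists_mk
    rw [MvN.zero_def, MvN.add_mk _ hp (zero_mul p)]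
    simp only [zero_add]
  add_zero a := by
    obtain ⟨p, hp, rfl⟩ := a.exists_mk
    rw [MvN.zero_def, MvN.add_mk hp _ (mul_zero p)]
    simp only [add_zero]
  nsmul := nsmulRec

/-- The map on classes of projections induced by a `*`-homomorphism. -/
def MvN.map {B : Type*} [NonUnitalRing B] [StarRing B] [OrthCopies B] (F : A →⋆ₙ+* B) : MvN A →+ MvN B where
  toFun := Quotient.lift (s := Proj.setoid A)
    (fun p => MvN.mk (F p.1) ⟨by
      rw [IsIdempotentElem, ← map_mul, p.2.isIdempotentElem.eq], by
      rw [IsSelfAdjoint, ← map_star, p.2.isSelfAdjoint.star_eq]⟩) (by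
      rintro p q ⟨x, h1, h2⟩
      exact MvN.mk_eq.2 ⟨F x, by rw [← map_star, ← map_mul, h1], by rw [← map_star, ← map_mul, h2]⟩)
  map_zero' := MvN.mk_eq.2 (by
    rw [show F (0 : A) = 0 from map_zero F]
    exact MvNRel.refl (IsStarProjection.zero B))
  map_add' a b := by
    obtain ⟨p, q, hp, hq, ho, rfl, rfl⟩ := MvN.exists_add a b
    rw [MvN.add_mk hp hq ho]
    change MvN.mk (F (p + q)) _ = MvN.mk (F p) _ + MvN.mk (F q) _
    rw [MvN.add_mk _ _ (by rw [← map_mul, ho, map_zero])]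
    simp only [map_add]

theorem MvN.map_mk {B : Type*} [NonUnitalRing B] [StarRing B] [OrthCopies B] (F : A →⋆ₙ+* B) (p : A) (hp : IsStarProjection p)
    (hp' : IsStarProjection (F p)) : MvN.map F (MvN.mk p hp) = MvN.mk (F p) hp' := rfl

end MvN

/-! ### The setting: `T`, `(T_n)`, `f` and `(C_n)` -/

/-- A group `T` which is the union of an increasing sequence of finite subgroups `Tn n`,
starting with the trivial one, and a Schur `E`-function `f` for `T`. -/
structure Setting (E T : Type*) [CommRing E] [StarRing E] [Group T] where
  /-- The subgroups. -/
  Tn : ℕ → Subgroup T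
  Tn_zero : Tn 0 = ⊥
  mono : Monotone Tn
  fin : ∀ n, Finite (Tn n)
  exhaust : ∀ t : T, ∃ n, t ∈ Tn n
  /-- The Schur function. -/
  f : T → T → E
  schur : IsSchurFunction f

namespace Setting

variable {E T : Type*} [CommRing E] [StarRing E] [Group T] (P : Setting E T)

instance (n : ℕ) : Fintype (P.Tn n) := @Fintype.ofFinite _ (P.fin n)

instance (n : ℕ) : DecidableEq (P.Tn n) := Classical.decEq _

/-- The restriction of `f` to `Tn n`. -/
def fn (n : ℕ) (r s : P.Tn n) : E := P.f r s

theorem schur_fn (n : ℕ) : IsSchurFunction (P.fn n) where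
  mem_unitary _ _ := P.schur.mem_unitary _ _
  one_one := P.schur.one_one
  cocycle _ _ _ := P.schur.cocycle _ _ _

variable (R : Type*) [Ring R] [StarRing R] [Algebra E R] [StarModule E R]

/-- The algebra `R_n` of the operators `∑ t ∈ T_n, (X t ⊗ id) V t` on `R^{T_n}`. -/
def alg (n : ℕ) : Type _ := twistedAlgebra R (P.schur_fn n)

instance (n : ℕ) : Ring (P.alg R n) := inferInstanceAs (Ring (twistedAlgebra R (P.schur_fn n)))

instance (n : ℕ) : StarRing (P.alg R n) :=
  inferInstanceAs (StarRing (twistedAlgebra R (P.schur_fn n)))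

instance (n : ℕ) : Algebra E (P.alg R n) :=
  inferInstanceAs (Algebra E (twistedAlgebra R (P.schur_fn n)))

instance (n : ℕ) : StarModule E (P.alg R n) :=
  inferInstanceAs (StarModule E (twistedAlgebra R (P.schur_fn n)))

/-- The canonical inclusion `R_n ⊆ R_{n+1}`. -/
def incl (n : ℕ) : P.alg R n →⋆ₐ[E] P.alg R (n + 1) :=
  ProjK.incl (P.schur_fn n) (P.schur_fn (n + 1)) (Subgroup.inclusion (P.mono n.le_succ))
    (Subgroup.inclusion_injective _) (fun _ _ => rfl)

variable {R} {R' R'' : Type*} [Ring R'] [StarRing R'] [Algebra E R'] [StarModule E R']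
  [Ring R''] [StarRing R''] [Algebra E R''] [StarModule E R'']

/-- The homomorphism `φ_n : R_n → R'_n` induced by `φ : R → R'`. -/
def algMap (φ : R →⋆ₐ[E] R') (n : ℕ) : P.alg R n →⋆ₐ[E] P.alg R' n := mapCoeff (P.schur_fn n) φ

theorem algMap_incl (φ : R →⋆ₐ[E] R') (n : ℕ) (X : P.alg R n) :
    P.algMap φ (n + 1) (P.incl R n X) = P.incl R' n (P.algMap φ n X) :=
  mapCoeff_incl ..

theorem algMap_comp (ψ : R' →⋆ₐ[E] R'') (φ : R →⋆ₐ[E] R') (n : ℕ) (X : P.alg R n) :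
    P.algMap (ψ.comp φ) n X = P.algMap ψ n (P.algMap φ n X) := rfl

end Setting

/-- The data on which projective K-theory depends: besides `T`, `(T_n)` and `f`, a sequence of
elements `C_n ∈ E_n`, `n ≥ 1`, commuting with `E_{n-1}`, such that `A_n = C_n* C_n` and
`B_n = C_n C_n*` are projections with sum `1`. Here `C n` is the element with index `n + 1`. -/
structure ProjSystem (E T : Type*) [CommRing E] [StarRing E] [Group T] extends Setting E T where
  /-- `C n` is the element of `E_{n+1}`. -/
  C : ∀ n, toSetting.alg E (n + 1)
  proj_A : ∀ n, IsStarProjection (star (C n) * C n)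
  proj_B : ∀ n, IsStarProjection (C n * star (C n))
  A_add_B : ∀ n, star (C n) * C n + C n * star (C n) = 1
  commute : ∀ n (X : toSetting.alg E n), C n * toSetting.incl E n X = toSetting.incl E n X * C n

namespace ProjSystem

variable {E T : Type*} [CommRing E] [StarRing E] [Group T] (P : ProjSystem E T)
variable (R : Type*) [Ring R] [StarRing R] [Algebra E R] [StarModule E R]

/-- `C_{n+1}` as an element of `R_{n+1}`. -/
def CR (n : ℕ) : P.alg R (n + 1) := P.algMap (StarAlgHom.ofId E R) (n + 1) (P.C n)

/-- `A_{n+1}` as an element of `R_{n+1}`. -/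
def AR (n : ℕ) : P.alg R (n + 1) := star (P.CR R n) * P.CR R n

/-- `B_{n+1}` as an element of `R_{n+1}`. -/
def BR (n : ℕ) : P.alg R (n + 1) := P.CR R n * star (P.CR R n)

theorem proj_AR (n : ℕ) : IsStarProjection (P.AR R n) := by
  have := (P.proj_A n).map (P.algMap (StarAlgHom.ofId E R) (n + 1))
  rwa [map_mul, map_star] at this

theorem A_add_BR (n : ℕ) : P.AR R n + P.BR R n = 1 := by
  have := congrArg (P.algMap (StarAlgHom.ofId E R) (n + 1)) (P.A_add_B n)
  rwa [map_add, map_mul, map_mul, map_star, map_one] at this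

theorem CR_comm (n : ℕ) (X : P.alg R n) :
    P.CR R n * P.incl R n X = P.incl R n X * P.CR R n :=
  commute_incl _ _ _ _ _ _ (P.commute n) X

theorem AR_comm (n : ℕ) (X : P.alg R n) :
    P.AR R n * P.incl R n X = P.incl R n X * P.AR R n := by
  have h := congrArg star (P.CR_comm R n (star X))
  rw [star_mul, star_mul, ← map_star, star_star] at h
  rw [AR, mul_assoc, P.CR_comm, ← mul_assoc, ← h, mul_assoc]

/-- `C_{n+1} A_{n+1}`; this is `C_{n+1}` itself when `E` is a C*-algebra. -/
def DR (n : ℕ) : P.alg R (n + 1) := P.CR R n * P.AR R n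

theorem star_DR_mul (n : ℕ) : star (P.DR R n) * P.DR R n = P.AR R n := by
  have hA : P.AR R n * P.AR R n = P.AR R n := (P.proj_AR R n).isIdempotentElem
  have hs : star (P.AR R n) = P.AR R n := (P.proj_AR R n).isSelfAdjoint
  rw [DR, star_mul, hs, mul_assoc, ← mul_assoc (star (P.CR R n)), ← AR, hA, hA]

theorem AR_mul_DR (n : ℕ) : P.AR R n * P.DR R n = 0 := by
  have hA : P.AR R n * P.AR R n = P.AR R n := (P.proj_AR R n).isIdempotentElem
  have hB : P.BR R n = 1 - P.AR R n := by rw [← P.A_add_BR R n]; abel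
  have h1 : P.DR R n = P.BR R n * P.CR R n := by rw [DR, AR, BR, mul_assoc]
  rw [h1, hB, ← mul_assoc, mul_sub, mul_one, hA, sub_self, zero_mul]

theorem DR_comm (n : ℕ) (X : P.alg R n) :
    P.DR R n * P.incl R n X = P.incl R n X * P.DR R n := by
  rw [DR, mul_assoc, P.AR_comm, ← mul_assoc, P.CR_comm, mul_assoc]

/-- The connecting map `R_n → R_{n+1}`, `X ↦ A_{n+1} X`. -/
def rho (n : ℕ) : P.alg R n →⋆ₙₐ[E] P.alg R (n + 1) where
  toFun X := P.AR R n * P.incl R n X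
  map_smul' e X := by simp
  map_zero' := by simp
  map_add' X Y := by simp [mul_add]
  map_mul' X Y := by
    have hA : P.AR R n * P.AR R n = P.AR R n := (P.proj_AR R n).isIdempotentElem
    rw [map_mul, mul_assoc, ← mul_assoc (P.incl R n X), ← P.AR_comm, ← mul_assoc, ← mul_assoc,
      ← mul_assoc, hA, mul_assoc]
  map_star' X := by
    have hA : star (P.AR R n) = P.AR R n := (P.proj_AR R n).isSelfAdjoint
    rw [star_mul, hA, ← map_star, P.AR_comm]

/-- The connecting maps `ρ_{n,m} : R_m → R_n`, `m ≤ n`. -/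
def rhoLE (m n : ℕ) (h : m ≤ n) : P.alg R m →⋆ₙₐ[E] P.alg R n :=
  Nat.leRec (motive := fun n _ => P.alg R m →⋆ₙₐ[E] P.alg R n) (NonUnitalStarAlgHom.id E _)
    (fun k _ g => (P.rho R k).comp g) h

theorem rhoLE_self (m : ℕ) (X : P.alg R m) : P.rhoLE R m m le_rfl X = X := by
  rw [rhoLE, Nat.leRec_self]; rfl

theorem rhoLE_succ (m n : ℕ) (h : m ≤ n) (X : P.alg R m) :
    P.rhoLE R m (n + 1) (h.trans n.le_succ) X = P.rho R n (P.rhoLE R m n h X) := by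
  rw [rhoLE, Nat.leRec_succ (h1 := h)]; rfl

instance directedSystem :
    DirectedSystem (fun n => P.alg R n) (fun m n h => P.rhoLE R m n h) where
  map_self i X := P.rhoLE_self R i X
  map_map k j i hij hjk X := by
    induction k, hjk using Nat.le_induction with
    | base => exact P.rhoLE_self R j _
    | succ k hjk ih =>
      rw [P.rhoLE_succ R j k hjk, ih, P.rhoLE_succ R i k (hij.trans hjk)]

/-- The algebraic inductive limit `R_→` of the system `(R_n)`. -/
def Lim : Type _ := DirectLimit (fun n => P.alg R n) (P.rhoLE R)

instance : NonUnitalRing (P.Lim R) :=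
  inferInstanceAs (NonUnitalRing (DirectLimit (fun n => P.alg R n) (P.rhoLE R)))

instance : StarRing (P.Lim R) :=
  inferInstanceAs (StarRing (DirectLimit (fun n => P.alg R n) (P.rhoLE R)))

/-- The canonical map `ρ_n : R_n → R_→`. -/
def toLim (n : ℕ) (X : P.alg R n) : P.Lim R := ⟦⟨n, X⟩⟧

theorem toLim_rho (n : ℕ) (X : P.alg R n) :
    P.toLim R (n + 1) (P.rho R n X) = P.toLim R n X := by
  have h : P.rho R n X = P.rhoLE R n (n + 1) n.le_succ X := by
    rw [P.rhoLE_succ R n n le_rfl, P.rhoLE_self]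
  rw [h]
  exact (DirectLimit.eq_of_le (f := P.rhoLE R) ⟨n, X⟩ (n + 1) n.le_succ).symm

theorem toLim_mul (n : ℕ) (X Y : P.alg R n) :
    P.toLim R n (X * Y) = P.toLim R n X * P.toLim R n Y :=
  (DirectLimit.mul_def n X Y).symm

theorem toLim_star (n : ℕ) (X : P.alg R n) :
    P.toLim R n (star X) = star (P.toLim R n X) := rfl

theorem toLim_zero (n : ℕ) : P.toLim R n 0 = 0 := (DirectLimit.zero_def n).symm

theorem toLim_add (n : ℕ) (X Y : P.alg R n) :
    P.toLim R n (X + Y) = P.toLim R n X + P.toLim R n Y :=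
  (DirectLimit.add_def n X Y).symm

theorem exists_toLim (x : P.Lim R) : ∃ n X, x = P.toLim R n X :=
  DirectLimit.exists_eq_mk (P.rhoLE R) x

theorem exists_toLim₂ (x y : P.Lim R) : ∃ n X Y, x = P.toLim R n X ∧ y = P.toLim R n Y :=
  DirectLimit.exists_eq_mk₂ (P.rhoLE R) x y

instance orthCopies : OrthCopies (P.Lim R) where
  exists_orth p q hp hq := by
    obtain ⟨n, p₀, q₀, rfl, rfl⟩ := P.exists_toLim₂ R p q
    have hqq : P.toLim R n q₀ * P.toLim R n q₀ = P.toLim R n q₀ := hq.isIdempotentElem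
    have hqs : star (P.toLim R n q₀) = P.toLim R n q₀ := hq.isSelfAdjoint
    set x₀ : P.Lim R := P.toLim R (n + 1) (P.DR R n * P.incl R n q₀) with hx₀
    have h1 : star x₀ * x₀ = P.toLim R n q₀ := by
      rw [hx₀, ← toLim_star, ← toLim_mul, star_mul, mul_assoc, ← mul_assoc (star (P.DR R n)),
        star_DR_mul, P.AR_comm, ← mul_assoc, ← map_star, ← map_mul, ← P.AR_comm]
      change P.toLim R (n + 1) (P.rho R n (star q₀ * q₀)) = _
      rw [toLim_rho, toLim_mul, toLim_star, hqs, hqq]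
    have h2 : P.toLim R n p₀ * x₀ = 0 := by
      rw [hx₀, ← P.toLim_rho R n p₀, ← toLim_mul]
      change P.toLim R (n + 1) (P.AR R n * P.incl R n p₀ * (P.DR R n * P.incl R n q₀)) = 0
      rw [mul_assoc, ← mul_assoc (P.incl R n p₀), ← P.DR_comm, ← mul_assoc, ← mul_assoc,
        AR_mul_DR, zero_mul, zero_mul, toLim_zero]
    have h3 : star (x₀ * P.toLim R n q₀) * (x₀ * P.toLim R n q₀) = P.toLim R n q₀ := by
      rw [star_mul, hqs, mul_assoc, ← mul_assoc (star x₀), h1, hqq, hqq]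
    refine ⟨x₀ * P.toLim R n q₀ * star (x₀ * P.toLim R n q₀), ⟨?_, ?_⟩, ⟨_, h3, rfl⟩, ?_⟩
    · rw [IsIdempotentElem, mul_assoc, ← mul_assoc (star (x₀ * P.toLim R n q₀)), h3,
        ← mul_assoc, mul_assoc x₀, hqq]
    · exact IsSelfAdjoint.mul_star_self _
    · rw [← mul_assoc, ← mul_assoc, h2, zero_mul, zero_mul]

variable {R} {R' R'' : Type*} [Ring R'] [StarRing R'] [Algebra E R'] [StarModule E R']
  [Ring R''] [StarRing R''] [Algebra E R''] [StarModule E R'']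

theorem algMap_CR (φ : R →⋆ₐ[E] R') (n : ℕ) : P.algMap φ (n + 1) (P.CR R n) = P.CR R' n := by
  rw [CR, CR, ← Setting.algMap_comp]
  congr 2
  ext e
  exact AlgHomClass.commutes φ e

theorem algMap_rho (φ : R →⋆ₐ[E] R') (n : ℕ) (X : P.alg R n) :
    P.algMap φ (n + 1) (P.rho R n X) = P.rho R' n (P.algMap φ n X) := by
  change P.algMap φ (n + 1) (star (P.CR R n) * P.CR R n * P.incl R n X) =
    star (P.CR R' n) * P.CR R' n * P.incl R' n (P.algMap φ n X)
  rw [map_mul, map_mul, map_star, algMap_CR, Setting.algMap_incl]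

theorem algMap_rhoLE (φ : R →⋆ₐ[E] R') (m n : ℕ) (h : m ≤ n) (X : P.alg R m) :
    P.rhoLE R' m n h (P.algMap φ m X) = P.algMap φ n (P.rhoLE R m n h X) := by
  induction n, h using Nat.le_induction with
  | base => rw [rhoLE_self, rhoLE_self]
  | succ n h ih => rw [P.rhoLE_succ R' m n h, P.rhoLE_succ R m n h, ih, algMap_rho]

/-- The homomorphism `φ_→ : R_→ → R'_→` as a map. -/
def limFun (φ : R →⋆ₐ[E] R') : P.Lim R → P.Lim R' :=
  DirectLimit.map (P.rhoLE R) (P.rhoLE R') (fun n => P.algMap φ n) (P.algMap_rhoLE φ)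

theorem limFun_toLim (φ : R →⋆ₐ[E] R') (n : ℕ) (X : P.alg R n) :
    P.limFun φ (P.toLim R n X) = P.toLim R' n (P.algMap φ n X) := rfl

/-- The homomorphism `φ_→ : R_→ → R'_→` with `φ_→ ∘ ρ_n = ρ_n ∘ φ_n`. -/
def limMap (φ : R →⋆ₐ[E] R') : P.Lim R →⋆ₙ+* P.Lim R' where
  toFun := P.limFun φ
  map_mul' x y := by
    obtain ⟨n, X, Y, rfl, rfl⟩ := P.exists_toLim₂ R x y
    rw [← toLim_mul, limFun_toLim, limFun_toLim, limFun_toLim, map_mul, toLim_mul]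
  map_zero' := by
    rw [← P.toLim_zero R 0, limFun_toLim, map_zero, toLim_zero]
  map_add' x y := by
    obtain ⟨n, X, Y, rfl, rfl⟩ := P.exists_toLim₂ R x y
    rw [← toLim_add, limFun_toLim, limFun_toLim, limFun_toLim, map_add, toLim_add]
  map_star' x := by
    obtain ⟨n, X, rfl⟩ := P.exists_toLim R x
    rw [← toLim_star, limFun_toLim, limFun_toLim, map_star, toLim_star]

theorem limMap_toLim (φ : R →⋆ₐ[E] R') (n : ℕ) (X : P.alg R n) :
    P.limMap φ (P.toLim R n X) = P.toLim R' n (P.algMap φ n X) := rfl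

theorem limMap_comp (ψ : R' →⋆ₐ[E] R'') (φ : R →⋆ₐ[E] R') (x : P.Lim R) :
    P.limMap (ψ.comp φ) x = P.limMap ψ (P.limMap φ x) := by
  obtain ⟨n, X, rfl⟩ := P.exists_toLim R x
  rw [limMap_toLim, limMap_toLim, limMap_toLim, Setting.algMap_comp]

/-! ### The functor `K₀` -/

/-- `K₀` of a unital algebra `R`: the Grothendieck group of the semigroup of Murray - von Neumann
classes of projections of `R_→`. -/
abbrev KU (R : Type*) [Ring R] [StarRing R] [Algebra E R] [StarModule E R] : Type _ :=
  Algebra.GrothendieckAddGroup (MvN (P.Lim R))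

/-- `K₀(φ)` for a unital `φ`, `K₀(φ) [p] = [φ_→ p]`. -/
def KUmap (φ : R →⋆ₐ[E] R') : P.KU R →+ P.KU R' :=
  Algebra.GrothendieckAddGroup.lift
    ((Algebra.GrothendieckAddGroup.of (M := MvN (P.Lim R'))).comp (MvN.map (P.limMap φ)))

theorem KUmap_of (φ : R →⋆ₐ[E] R') (a : MvN (P.Lim R)) :
    P.KUmap φ (Algebra.GrothendieckAddGroup.of a) =
      Algebra.GrothendieckAddGroup.of (MvN.map (P.limMap φ) a) :=
  DFunLike.congr_fun (Algebra.GrothendieckAddGroup.lift.symm_apply_apply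
    ((Algebra.GrothendieckAddGroup.of (M := MvN (P.Lim R'))).comp (MvN.map (P.limMap φ)))) a

theorem KUmap_comp (ψ : R' →⋆ₐ[E] R'') (φ : R →⋆ₐ[E] R') :
    P.KUmap (ψ.comp φ) = (P.KUmap ψ).comp (P.KUmap φ) := by
  apply Algebra.GrothendieckAddGroup.lift.symm.injective
  ext a
  change P.KUmap (ψ.comp φ) (Algebra.GrothendieckAddGroup.of a) =
    P.KUmap ψ (P.KUmap φ (Algebra.GrothendieckAddGroup.of a))
  rw [KUmap_of, KUmap_of, KUmap_of]
  obtain ⟨p, hp, rfl⟩ := a.exists_mk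
  congr 1
  exact MvN.mk_eq.2 (by
    rw [limMap_comp]
    exact MvNRel.refl ((hp.map (P.limMap φ)).map (P.limMap ψ)))

end ProjSystem

/-! ### `K₀` of an `E`-C*-algebra

`Unitization E F` is the vector space `E × F` with the product
`(α, x) (β, y) = (α β, α y + β x + x y)`, the involution `(α, x)* = (α*, x*)` and the embedding
`α ↦ (α, 0)` of `E`. -/

section nonunital

variable {E : Type*} [CommRing E] [StarRing E]
variable (F : Type*) [NonUnitalRing F] [StarRing F] [Module E F] [IsScalarTower E F F]
  [SMulCommClass E F F] [StarModule E F]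

/-- `π : E × F → E`, `(α, x) ↦ α`. -/
def unitPi (E : Type*) [CommRing E] [StarRing E] (F : Type*) [NonUnitalRing F] [StarRing F]
    [Module E F] [IsScalarTower E F F] [SMulCommClass E F F] [StarModule E F] :
    Unitization E F →⋆ₐ[E] E where
  toAlgHom := Unitization.fstHom E F
  map_star' _ := rfl

theorem unitPi_apply (x : Unitization E F) : unitPi E F x = x.fst := rfl

variable {F} {G : Type*} [NonUnitalRing G] [StarRing G] [Module E G] [IsScalarTower E G G]
  [SMulCommClass E G G] [StarModule E G]

theorem unitPi_comp (φ : F →⋆ₙₐ[E] G) :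
    (unitPi E G).comp (Unitization.starMap φ) = unitPi E F := by
  apply StarAlgHom.ext
  intro x
  induction x using Unitization.ind with
  | inl_add_inr α x => simp [unitPi_apply, Unitization.algebraMap_eq_inl]

namespace ProjSystem

variable {T : Type*} [Group T] (P : ProjSystem E T)

/-- `K₀(F)`, the kernel of `K₀(π)`. -/
abbrev K0 (F : Type*) [NonUnitalRing F] [StarRing F] [Module E F] [IsScalarTower E F F]
    [SMulCommClass E F F] [StarModule E F] : Type _ := (P.KUmap (unitPi E F)).ker

/-- `K₀(φ)`, the restriction of `K₀` of `(α, x) ↦ (α, φ x)`. -/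
def K0map (φ : F →⋆ₙₐ[E] G) : P.K0 F →+ P.K0 G :=
  ((P.KUmap (Unitization.starMap φ)).comp (P.KUmap (unitPi E F)).ker.subtype).codRestrict
    (P.KUmap (unitPi E G)).ker (fun a => by
      have h := P.KUmap_comp (unitPi E G) (Unitization.starMap φ)
      rw [unitPi_comp] at h
      have ha : P.KUmap (unitPi E F) a = 0 := a.2
      exact (DFunLike.congr_fun h a.1).symm.trans ha)

end ProjSystem

end nonunital

end ProjK

end

/-! ### Projections, Grothendieck groups and coefficients. -/

namespace ProjK

/-! Write `A`, `B`, `D` for the unitizations of `F`, `G`, `H`. Exactness of the given sequence says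
that `A` is the pullback of the split surjection `ψ : B → D` along `E → D`. The theorem is therefore
split excision: `ker (K₀(A) → K₀(E))` maps bijectively onto `ker (K₀(B) → K₀(D))`. Passing to
coefficients and to the limit preserves the pullback property: an element of `B_→` whose image in
`D_→` has coefficients in `E` comes from `A_→` (`exists_limMap_eq`).

Surjectivity: a class killed by `ψ` has the form `[p] - [q]` with `q` over `E` and `ψ p` equivalent
to `q`. After moving `q` orthogonally away, a symmetry `u` in a corner of `D_→` exchanges `ψ p` and
`q`. The section lifts `u` to a symmetry `v` over `B`, and `v p v` is equivalent to `p` and maps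
exactly onto `q`, so it comes from `A_→` (`exists_eq_of_sub_of`).

Injectivity: a class in the kernel is `[p] - [q]` with `p` over `A` lying exactly above `q`. If it
dies in `K₀(B)`, then after adding a common projection over `E` some `w` over `B` implements `p ~
q`. With `σ = lam ∘ ψ`, the element `σ(w)* w` still implements the equivalence, and its image in
`D_→` is `q`, so it descends to `A_→` (`mvnRel_of_pullback`).

The section takes the place of any lifting of unitaries up to homotopy, so the argument is purely
algebraic. -/

theorem isStarProjection_map {A B : Type*} [NonUnitalRing A] [StarRing A] [NonUnitalRing B]
    [StarRing B] (F : A →⋆ₙ+* B) {p : A} (hp : IsStarProjection p) : IsStarProjection (F p) :=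
  ⟨by rw [IsIdempotentElem, ← map_mul, hp.isIdempotentElem.eq],
    by rw [IsSelfAdjoint, ← map_star, hp.isSelfAdjoint.star_eq]⟩

theorem isStarProjection_of_map {A B : Type*} [NonUnitalRing A] [StarRing A] [NonUnitalRing B]
    [StarRing B] (F : A →⋆ₙ+* B) (hF : Function.Injective F) {p : A}
    (hp : IsStarProjection (F p)) : IsStarProjection p :=
  ⟨hF (by rw [map_mul, hp.isIdempotentElem.eq]),
    hF (by rw [map_star, hp.isSelfAdjoint.star_eq])⟩

theorem exists_of_sub_of {M : Type*} [AddCommMonoid M] (a : Algebra.GrothendieckAddGroup M) :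
    ∃ x y : M, a = Algebra.GrothendieckAddGroup.of x - Algebra.GrothendieckAddGroup.of y := by
  obtain ⟨⟨x, y⟩, h⟩ := (AddLocalization.addMonoidOf (⊤ : AddSubmonoid M)).surj a
  exact ⟨x, y, eq_sub_of_add_eq h⟩

theorem of_eq_of_iff {M : Type*} [AddCommMonoid M] {x y : M} :
    Algebra.GrothendieckAddGroup.of x = Algebra.GrothendieckAddGroup.of y ↔
      ∃ c, x + c = y + c := by
  refine (AddLocalization.addMonoidOf (⊤ : AddSubmonoid M)).eq_iff_exists.trans ?_
  constructor
  · rintro ⟨c, h⟩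
    exact ⟨c, by rw [add_comm x, add_comm y, h]⟩
  · rintro ⟨c, h⟩
    exact ⟨⟨c, AddSubmonoid.mem_top c⟩, by rw [add_comm _ x, add_comm _ y, h]⟩

theorem MvNRel.map {A B : Type*} [NonUnitalRing A] [StarRing A] [NonUnitalRing B]
    [StarRing B] {p q : A} (h : MvNRel p q) (F : A →⋆ₙ+* B) : MvNRel (F p) (F q) := by
  obtain ⟨x, rfl, rfl⟩ := h
  exact ⟨F x, by rw [map_mul, map_star], by rw [map_mul, map_star]⟩

/-- If `x` is a partial isometry from `p` to `q` and `p`, `q` are orthogonal and below the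
projection `e`, then `x + x* + (e - p - q)` is a symmetry in the corner of `e` that exchanges
`p` and `q`. -/
theorem exists_symmetry {A : Type*} [NonUnitalRing A] [StarRing A] {p q e : A}
    (hp : IsStarProjection p) (hq : IsStarProjection q) (he : IsStarProjection e)
    (hpq : MvNRel p q) (ho : p * q = 0) (hep : e * p = p) (heq : e * q = q) :
    ∃ u : A, star u = u ∧ u * u = e ∧ u * p * u = q := by
  obtain ⟨x, h1, h2, h3, h4⟩ := hpq.exists_partial hp hq
  have ho' := orth_symm hp hq ho
  have hps : star p = p := hp.isSelfAdjoint
  have hqs : star q = q := hq.isSelfAdjoint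
  have hes : star e = e := he.isSelfAdjoint
  have hpp : p * p = p := hp.isIdempotentElem
  have hqq : q * q = q := hq.isIdempotentElem
  have hee : e * e = e := he.isIdempotentElem
  have hpe : p * e = p := by simpa [hps, hes] using congrArg star hep
  have hqe : q * e = q := by simpa [hqs, hes] using congrArg star heq
  have h3' : p * star x = star x := by simpa [hps] using congrArg star h3
  have h4' : star x * q = star x := by simpa [hqs] using congrArg star h4
  -- As `x = q x p`, orthogonality of `p` and `q` annihilates every product in which they meet.
  have hqx : x * q = 0 := by rw [← h3, mul_assoc, ho, mul_zero]
  have hpx : p * x = 0 := by rw [← h4, ← mul_assoc, ho, zero_mul]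
  have hxp : star x * p = 0 := by simpa [hps] using congrArg star hpx
  have hxq : q * star x = 0 := by simpa [hqs] using congrArg star hqx
  have hxx : x * x = 0 := by
    nth_rewrite 2 [← h4]
    rw [← mul_assoc, hqx, zero_mul]
  have hxx' : star x * star x = 0 := by simpa using congrArg star hxx
  have hex : e * x = x := by rw [← h4, ← mul_assoc, heq]
  have hxe : x * e = x := by rw [← h3, mul_assoc, hpe]
  have hex' : e * star x = star x := by simpa [hes] using congrArg star hxe
  have hxe' : star x * e = star x := by simpa [hes] using congrArg star hex
  refine ⟨x + star x + (e - p - q), ?_, ?_, ?_⟩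
  · simp only [star_add, star_sub, star_star, hps, hqs, hes]
    abel
  -- `(x + x*)² = x* x + x x* = p + q`, and `e - p - q` is a projection orthogonal to this part.
  · simp only [mul_add, add_mul, mul_sub, sub_mul, h1, h2, h3, h4, h3', h4', hqx, hpx, hxp, hxq,
      hxx, hxx', hex, hxe, hex', hxe', hpp, hqq, hee, hpe, hqe, hep, heq, ho, ho']
    abel
  -- Here `u p = x`, and `x u = x x* = q`.
  · simp only [add_mul, sub_mul, h3, hxp, hep, hpp, ho', mul_add, mul_sub, h2, hxx, hxe, hqx]
    abel

/-- An operator whose image under `ψ` has coefficients in `E` comes from `R` if this holds for its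
coefficients. -/
theorem exists_mapCoeff_eq {S E R R' R'' : Type*} [Group S] [Fintype S] [DecidableEq S]
    [CommRing E] [StarRing E] [Ring R] [StarRing R] [Algebra E R] [StarModule E R]
    [Ring R'] [StarRing R'] [Algebra E R'] [StarModule E R']
    [Ring R''] [StarRing R''] [Algebra E R''] [StarModule E R'']
    {g : S → S → E} (hg : IsSchurFunction g) {φ : R →⋆ₐ[E] R'} {ψ : R' →⋆ₐ[E] R''}
    (hφψ : ∀ b e, ψ b = algebraMap E R'' e → ∃ a, φ a = b)
    {Y : twistedAlgebra R' hg} {Z : twistedAlgebra E hg}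
    (h : mapCoeff hg ψ Y = mapCoeff hg (StarAlgHom.ofId E R'') Z) :
    ∃ X, mapCoeff hg φ X = Y := by
  -- Coefficients are the entries of the column at `1`, so each coefficient of `Y` is sent by `ψ` to
  -- an entry of `Z`, hence into `E`.
  have hX : ∀ t, ∃ a, φ a = coeff (Y : Matrix S S R') t := fun t =>
    hφψ _ ((Z : Matrix S S E) t 1) (congrFun (congrFun (congrArg Subtype.val h) t) 1)
  choose W hW using hX
  refine ⟨⟨ofCoeff g W, ⟨W, rfl⟩⟩, Subtype.ext ?_⟩
  ext s s'
  rw [← ofCoeff_coeff hg Y]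
  change φ (ofCoeff g W s s') = _
  rw [ofCoeff_apply, ofCoeff_apply, map_mul, hW, AlgHomClass.commutes]

/-! ### Units and exactness properties of the limit algebra. -/

namespace ProjSystem

variable {E T : Type*} [CommRing E] [StarRing E] [Group T] (P : ProjSystem E T)

section
variable (R : Type*) [Ring R] [StarRing R] [Algebra E R] [StarModule E R]

theorem toLim_rhoLE (m n : ℕ) (h : m ≤ n) (X : P.alg R m) :
    P.toLim R n (P.rhoLE R m n h X) = P.toLim R m X :=
  (DirectLimit.eq_of_le (f := P.rhoLE R) ⟨m, X⟩ n h).symm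

theorem toLim_eq_zero {n : ℕ} {X : P.alg R n} (h : P.toLim R n X = 0) :
    ∃ m, ∃ hm : n ≤ m, P.rhoLE R n m hm X = 0 := by
  rw [← P.toLim_zero R n] at h
  obtain ⟨m, h1, h2, h3⟩ := Quotient.exact h
  exact ⟨m, h1, by simpa using h3⟩

/-- The image in `R_→` of the unit of `R_n`. -/
noncomputable def limUnit (n : ℕ) : P.Lim R := P.toLim R n 1

theorem isStarProjection_limUnit (n : ℕ) : IsStarProjection (P.limUnit R n) :=
  ⟨by rw [IsIdempotentElem, limUnit, ← toLim_mul, one_mul],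
    by rw [IsSelfAdjoint, limUnit, ← toLim_star, star_one]⟩

/-- The connecting maps need not be unital, so the images of the units of the `R_n` act only as
local units: `1 ∈ R_m` fixes everything that comes from `R_m`. -/
theorem exists_limUnit_mul (x : P.Lim R) :
    ∃ n, ∀ m, n ≤ m → P.limUnit R m * x = x ∧ x * P.limUnit R m = x := by
  obtain ⟨n, X, rfl⟩ := P.exists_toLim R x
  refine ⟨n, fun m hm => ?_⟩
  rw [← P.toLim_rhoLE R n m hm, limUnit, ← toLim_mul, ← toLim_mul, one_mul, mul_one]
  exact ⟨rfl, rfl⟩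

/-- The class of the image of the unit of `R_n`. -/
noncomputable def unitClass (n : ℕ) : MvN (P.Lim R) := MvN.mk (P.limUnit R n) (P.isStarProjection_limUnit R n)

/-- A projection lies below a local unit, and its complement there is again a projection. Thus unit
classes, which are defined over `E` and preserved by all induced maps, can replace arbitrary classes
when subtracting or stabilising. -/
theorem exists_add_eq_unitClass (a : MvN (P.Lim R)) : ∃ b n, a + b = P.unitClass R n := by
  obtain ⟨p, hp, rfl⟩ := a.exists_mk
  obtain ⟨n, hn⟩ := P.exists_limUnit_mul R p
  obtain ⟨h1, h2⟩ := hn n le_rfl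
  have hu := P.isStarProjection_limUnit R n
  have ho : p * (P.limUnit R n - p) = 0 := by rw [mul_sub, h2, hp.isIdempotentElem.eq, sub_self]
  have hq : IsStarProjection (P.limUnit R n - p) :=
    ⟨by rw [IsIdempotentElem, sub_mul, ho, mul_sub, hu.isIdempotentElem.eq, h1, sub_zero],
      hu.isSelfAdjoint.sub hp.isSelfAdjoint⟩
  refine ⟨MvN.mk _ hq, n, ?_⟩
  rw [MvN.add_mk hp hq ho, unitClass]
  simp only [add_sub_cancel]

theorem exists_of_sub_unitClass (a : P.KU R) : ∃ x n, a =
    Algebra.GrothendieckAddGroup.of x - Algebra.GrothendieckAddGroup.of (P.unitClass R n) := by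
  obtain ⟨x, y, rfl⟩ := exists_of_sub_of a
  obtain ⟨b, n, h⟩ := P.exists_add_eq_unitClass R y
  exact ⟨x + b, n, by rw [← h, map_add, map_add, add_sub_add_right_eq_sub]⟩

theorem exists_add_unitClass_eq {x y : MvN (P.Lim R)}
    (h : Algebra.GrothendieckAddGroup.of x = Algebra.GrothendieckAddGroup.of y) :
    ∃ n, x + P.unitClass R n = y + P.unitClass R n := by
  obtain ⟨c, h⟩ := of_eq_of_iff.1 h
  obtain ⟨b, n, hb⟩ := P.exists_add_eq_unitClass R c
  exact ⟨n, by rw [← hb, ← add_assoc, h, add_assoc]⟩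

end

variable {R R' R'' : Type*} [Ring R] [StarRing R] [Algebra E R] [StarModule E R]
  [Ring R'] [StarRing R'] [Algebra E R'] [StarModule E R']
  [Ring R''] [StarRing R''] [Algebra E R''] [StarModule E R'']

theorem limMap_limUnit (φ : R →⋆ₐ[E] R') (n : ℕ) :
    P.limMap φ (P.limUnit R n) = P.limUnit R' n := by
  rw [limUnit, limMap_toLim, map_one, limUnit]

theorem map_unitClass (φ : R →⋆ₐ[E] R') (n : ℕ) :
    MvN.map (P.limMap φ) (P.unitClass R n) = P.unitClass R' n := by
  rw [unitClass, MvN.map_mk _ _ _ (isStarProjection_map _ (P.isStarProjection_limUnit R n))]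
  simp only [limMap_limUnit, unitClass]

theorem limMap_ofId (φ : R →⋆ₐ[E] R') (x : P.Lim E) :
    P.limMap φ (P.limMap (StarAlgHom.ofId E R) x) = P.limMap (StarAlgHom.ofId E R') x := by
  rw [← limMap_comp]
  congr 2
  exact StarAlgHom.ext fun e => AlgHomClass.commutes φ e

theorem limMap_id (x : P.Lim R) : P.limMap (StarAlgHom.id E R) x = x := by
  obtain ⟨n, X, rfl⟩ := P.exists_toLim R x
  rfl

theorem limMap_of_comp_eq_id {φ : R →⋆ₐ[E] R'} {ψ : R' →⋆ₐ[E] R}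
    (h : ψ.comp φ = StarAlgHom.id E R) (x : P.Lim R) : P.limMap ψ (P.limMap φ x) = x := by
  rw [← limMap_comp, h, limMap_id]

theorem KUmap_id (a : P.KU R) : P.KUmap (StarAlgHom.id E R) a = a := by
  obtain ⟨x, y, rfl⟩ := exists_of_sub_of a
  have h : ∀ x : MvN (P.Lim R), MvN.map (P.limMap (StarAlgHom.id E R)) x = x := by
    intro x
    obtain ⟨p, hp, rfl⟩ := x.exists_mk
    rw [MvN.map_mk _ _ _ (isStarProjection_map _ hp)]
    simp only [limMap_id]
  rw [map_sub, KUmap_of, KUmap_of, h, h]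

theorem KUmap_of_comp_eq_id {φ : R →⋆ₐ[E] R'} {ψ : R' →⋆ₐ[E] R}
    (h : ψ.comp φ = StarAlgHom.id E R) (a : P.KU R) : P.KUmap ψ (P.KUmap φ a) = a := by
  rw [← AddMonoidHom.comp_apply, ← KUmap_comp, h, KUmap_id]

theorem algMap_injective {φ : R →⋆ₐ[E] R'} (hφ : Function.Injective φ) (n : ℕ) :
    Function.Injective (P.algMap φ n) := fun _ _ h =>
  Subtype.ext (Matrix.map_injective hφ (congrArg Subtype.val h))

/-- An element that vanishes in the limit already vanishes at a finite stage, where injectivity is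
checked entrywise. -/
theorem limMap_injective {φ : R →⋆ₐ[E] R'} (hφ : Function.Injective φ) :
    Function.Injective (P.limMap φ) := by
  rw [injective_iff_map_eq_zero]
  intro x hx
  obtain ⟨n, X, rfl⟩ := P.exists_toLim R x
  rw [limMap_toLim] at hx
  obtain ⟨m, hm, h⟩ := P.toLim_eq_zero R' hx
  rw [algMap_rhoLE] at h
  rw [← P.toLim_rhoLE R n m hm, P.algMap_injective hφ m (h.trans (map_zero _).symm), toLim_zero]

/-- The functor `R ↦ R_→` is exact in the middle: an element of `R'_→` whose image in `R''_→` has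
coefficients in `E` comes from `R_→` if this holds at the level of coefficients. -/
theorem exists_limMap_eq {φ : R →⋆ₐ[E] R'} {ψ : R' →⋆ₐ[E] R''}
    (hφψ : ∀ b e, ψ b = algebraMap E R'' e → ∃ a, φ a = b)
    {y : P.Lim R'} {z : P.Lim E} (h : P.limMap ψ y = P.limMap (StarAlgHom.ofId E R'') z) :
    ∃ x, P.limMap φ x = y := by
  obtain ⟨k, Y, rfl⟩ := P.exists_toLim R' y
  obtain ⟨l, Z, rfl⟩ := P.exists_toLim E z
  -- Equality in the limit is equality at some stage `m`, where the statement about coefficients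
  -- applies.
  obtain ⟨m, h1, h2, h3⟩ := Quotient.exact h
  change P.rhoLE R'' k m h1 (P.algMap ψ k Y) =
    P.rhoLE R'' l m h2 (P.algMap (StarAlgHom.ofId E R'') l Z) at h3
  rw [algMap_rhoLE, algMap_rhoLE] at h3
  obtain ⟨X, hX⟩ : ∃ X : P.alg R m, P.algMap φ m X = P.rhoLE R' k m h1 Y :=
    exists_mapCoeff_eq (P.schur_fn m) hφψ h3
  refine ⟨P.toLim R m X, ?_⟩
  rw [limMap_toLim, hX, toLim_rhoLE]

end ProjSystem

end ProjK

/-! ### Split excision for pullbacks. -/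

namespace ProjK

namespace ProjSystem

variable {E T : Type*} [CommRing E] [StarRing E] [Group T] (P : ProjSystem E T)
variable {A B D : Type*} [Ring A] [StarRing A] [Algebra E A] [StarModule E A]
  [Ring B] [StarRing B] [Algebra E B] [StarModule E B]
  [Ring D] [StarRing D] [Algebra E D] [StarModule E D]

/-- Every element of the kernel of `K₀(ψ)`, `ψ` a split surjection, is a difference `[p] - [q]`
where `q` has coefficients in `E` and `ψ p = q`. -/
theorem exists_eq_of_sub_of {ψ : B →⋆ₐ[E] D} {lam : D →⋆ₐ[E] B}
    (hlam : ψ.comp lam = StarAlgHom.id E D) {a : P.KU B} (ha : P.KUmap ψ a = 0) :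
    ∃ (p : P.Lim B) (q : P.Lim E) (hp : IsStarProjection p) (hq : IsStarProjection q),
      a = Algebra.GrothendieckAddGroup.of (MvN.mk p hp) -
        Algebra.GrothendieckAddGroup.of (MvN.mk _
          (isStarProjection_map (P.limMap (StarAlgHom.ofId E B)) hq)) ∧
      P.limMap ψ p = P.limMap (StarAlgHom.ofId E D) q := by
  obtain ⟨x, n, rfl⟩ := P.exists_of_sub_unitClass B a
  rw [map_sub, KUmap_of, KUmap_of, map_unitClass, sub_eq_zero] at ha
  obtain ⟨m, h⟩ := P.exists_add_unitClass_eq D ha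
  -- Adding `[1_m]` to both terms of the difference leaves `a` unchanged and turns equality in
  -- `K₀(D)` into equivalence of projections. The second term is represented over `E`.
  obtain ⟨p, hp, hpx⟩ := (x + P.unitClass B m).exists_mk
  obtain ⟨q₀, hq₀, hqx⟩ := (P.unitClass E n + P.unitClass E m).exists_mk
  obtain ⟨N, hN⟩ := P.exists_limUnit_mul B p
  -- Orthogonality to `1_N`, which dominates `p`, can be arranged over `E` and gives orthogonality
  -- to `ψ p` after mapping to `D_→`.
  obtain ⟨q, hq, hqq, ho⟩ := OrthCopies.exists_orth (P.limUnit E N) q₀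
    (P.isStarProjection_limUnit E N) hq₀
  obtain ⟨N', hN'⟩ := P.exists_limUnit_mul E q
  rw [MvN.mk_eq (hp := hq₀) (hq := hq) |>.2 hqq] at hqx
  have hpD := isStarProjection_map (P.limMap ψ) hp
  have hqB := isStarProjection_map (P.limMap (StarAlgHom.ofId E B)) hq
  have hqD := isStarProjection_map (P.limMap (StarAlgHom.ofId E D)) hq
  have hrel : MvNRel (P.limMap ψ p) (P.limMap (StarAlgHom.ofId E D) q) := by
    rw [← MvN.mk_eq (hp := hpD) (hq := hqD), ← MvN.map_mk _ p hp, ← MvN.map_mk _ q hq, ← hpx,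
      ← hqx, map_add, map_add, map_unitClass, map_unitClass, map_unitClass, h]
  have horth : P.limMap ψ p * P.limMap (StarAlgHom.ofId E D) q = 0 := by
    rw [← (hN N le_rfl).2, map_mul, limMap_limUnit,
      ← P.limMap_limUnit (StarAlgHom.ofId E D), mul_assoc, ← map_mul, ho, map_zero, mul_zero]
  obtain ⟨u, hus, huu, hu⟩ := exists_symmetry hpD hqD (P.isStarProjection_limUnit D (max N N'))
    hrel horth
    (by rw [← P.limMap_limUnit ψ, ← map_mul, (hN _ (le_max_left _ _)).1])
    (by rw [← P.limMap_limUnit (StarAlgHom.ofId E D), ← map_mul, (hN' _ (le_max_right _ _)).1])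
  -- The splitting enters here: `lam` preserves local units, so `v` is again a symmetry of the
  -- corner of `1_(max N N')`, now over `B`.
  set v := P.limMap lam u with hv
  have hvs : star v = v := by rw [hv, ← map_star, hus]
  have hvp : v * (v * p) = p := by
    rw [← mul_assoc, hv, ← map_mul, huu, limMap_limUnit, (hN _ (le_max_left _ _)).1]
  have hpp : p * p = p := hp.isIdempotentElem
  have hps : star p = p := hp.isSelfAdjoint
  have hp' : IsStarProjection (v * p * v) := by
    constructor
    · rw [IsIdempotentElem]
      calc v * p * v * (v * p * v) = v * (p * (v * (v * p))) * v := by simp only [mul_assoc]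
        _ = v * p * v := by rw [hvp, hpp]
    · rw [IsSelfAdjoint, star_mul, star_mul, hvs, hps, mul_assoc]
  refine ⟨v * p * v, q, hp', hq, ?_, ?_⟩
  · have hrel' : MvNRel (v * p * v) p := by
      refine MvNRel.symm ⟨v * p, ?_, ?_⟩
      · rw [star_mul, hvs, hps, mul_assoc, hvp, hpp]
      · rw [star_mul, hvs, hps, mul_assoc, ← mul_assoc p, hpp, ← mul_assoc]
    rw [MvN.mk_eq (hp := hp') (hq := hp) |>.2 hrel', ← MvN.map_mk _ q hq, ← hpx, ← hqx, map_add,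
      map_add (MvN.map _), map_unitClass, map_unitClass, map_add, add_sub_add_right_eq_sub]
  · rw [map_mul, map_mul, hv, P.limMap_of_comp_eq_id hlam, hu]

/-- The image in `R_→` of a copy of the unit of `E_n` is a copy of the unit of `R_n`. -/
theorem mvnRel_ofId {n : ℕ} {e : P.Lim E} (he : MvNRel (P.limUnit E n) e) :
    MvNRel (P.limUnit A n) (P.limMap (StarAlgHom.ofId E A) e) :=
  P.limMap_limUnit (StarAlgHom.ofId E A) n ▸ he.map _

/-- Used to realise stabilisation by `[1_n]` as the sum with a concrete projection, which can then
be followed through the pullback square. -/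
theorem mk_add_of_orth {p e : P.Lim A} {n : ℕ} (hp : IsStarProjection p)
    (he : IsStarProjection e) (hne : MvNRel (P.limUnit A n) e) (ho : p * e = 0) :
    MvN.mk (p + e) (orth_add hp he ho) = MvN.mk p hp + P.unitClass A n := by
  rw [← MvN.add_mk hp he ho, unitClass, MvN.mk_eq.2 hne]

/-- Let `A` be the pullback of a split surjection `ψ : B → D` along `E → D`. A projection of `A_→`
whose image in `D_→` is a projection `q` of `E_→` and which is equivalent to `q` in `B_→` is
equivalent to `q` in `A_→`. -/
theorem mvnRel_of_pullback {α : A →⋆ₐ[E] B} {ψ : B →⋆ₐ[E] D} {lam : D →⋆ₐ[E] B}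
    (hα : Function.Injective α) (hlam : ψ.comp lam = StarAlgHom.id E D)
    (hex : ∀ b e, ψ b = algebraMap E D e → ∃ a, α a = b)
    {p : P.Lim A} {q : P.Lim E} (hp : IsStarProjection p)
    (hψ : P.limMap ψ (P.limMap α p) = P.limMap (StarAlgHom.ofId E D) q)
    (h : MvNRel (P.limMap α p) (P.limMap (StarAlgHom.ofId E B) q)) :
    MvNRel p (P.limMap (StarAlgHom.ofId E A) q) := by
  obtain ⟨w, h1, h2⟩ := h
  -- `w` itself need not come from `A_→`, since `ψ w` is only some unitary of the corner of `q`.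
  -- Multiplying by `σ(w)*` cancels it: `ψ σ = ψ`, so `ψ (σ(w)* w) = ψ (w* w) = q`.
  set σ : P.Lim B →⋆ₙ+* P.Lim B := P.limMap (lam.comp ψ) with hσ
  have hσ1 : σ (P.limMap α p) = P.limMap (StarAlgHom.ofId E B) q := by
    rw [hσ, limMap_comp, hψ, limMap_ofId]
  have hσ2 : σ (P.limMap (StarAlgHom.ofId E B) q) = P.limMap (StarAlgHom.ofId E B) q :=
    P.limMap_ofId _ _
  have hpp := (isStarProjection_map (P.limMap α) hp).isIdempotentElem.eq
  have hψw : P.limMap ψ (star (σ w) * w) = P.limMap (StarAlgHom.ofId E D) q := by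
    rw [← hψ, ← h1, map_mul, map_mul, map_star, map_star, hσ, limMap_comp,
      P.limMap_of_comp_eq_id hlam]
  obtain ⟨v, hv⟩ := P.exists_limMap_eq hex hψw
  -- Both identities are checked in `B_→`, using that `σ` fixes `q = w w*` and sends `p = w* w` to
  -- `q`.
  refine ⟨v, P.limMap_injective hα ?_, P.limMap_injective hα ?_⟩
  · rw [map_mul, map_star, hv, star_mul, star_star]
    calc star w * σ w * (star (σ w) * w) = star w * σ (w * star w) * w := by
          rw [map_mul, map_star]; simp only [mul_assoc]
      _ = star w * w * (star w * w) := by rw [h2, hσ2, ← h2]; simp only [mul_assoc]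
      _ = P.limMap α p := by rw [h1, hpp]
  · rw [map_mul, map_star, hv, star_mul, star_star, limMap_ofId]
    calc star (σ w) * w * (star w * σ w) = star (σ w) * (w * star w) * σ w := by
          simp only [mul_assoc]
      _ = σ (star w * (w * star w) * w) := by
          rw [h2, map_mul, map_mul, map_star, hσ2]
      _ = σ (star w * w * (star w * w)) := by simp only [mul_assoc]
      _ = P.limMap (StarAlgHom.ofId E B) q := by rw [h1, hpp, hσ1]

/-- Split excision, injectivity: if `A` is the pullback of a split surjection `ψ : B → D` along
`E → D`, then the kernel of `K₀(A) → K₀(E)` embeds into `K₀(B)`. -/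
theorem KUmap_pullback_injective {α : A →⋆ₐ[E] B} {π : A →⋆ₐ[E] E} {ψ : B →⋆ₐ[E] D}
    {lam : D →⋆ₐ[E] B} (hα : Function.Injective α)
    (hψα : ψ.comp α = (StarAlgHom.ofId E D).comp π)
    (hlam : ψ.comp lam = StarAlgHom.id E D)
    (hex : ∀ b e, ψ b = algebraMap E D e → ∃ a, α a = b)
    {a : P.KU A} (hπ : P.KUmap π a = 0) (ha : P.KUmap α a = 0) : a = 0 := by
  have hsec : π.comp (StarAlgHom.ofId E A) = StarAlgHom.id E E :=
    StarAlgHom.ext fun e => AlgHomClass.commutes π e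
  -- The normal form is applied to `π`, which is split by `E → A`.
  obtain ⟨p, q, hp, hq, rfl, hpq⟩ := P.exists_eq_of_sub_of hsec hπ
  have hqA := isStarProjection_map (P.limMap (StarAlgHom.ofId E A)) hq
  have hαp := isStarProjection_map (P.limMap α) hp
  have hqB := isStarProjection_map (P.limMap (StarAlgHom.ofId E B)) hq
  have hαq : MvN.map (P.limMap α) (MvN.mk _ hqA) = MvN.mk _ hqB := by
    rw [MvN.map_mk _ _ _ (isStarProjection_map (P.limMap α) hqA)]
    simp only [limMap_ofId]
  rw [map_sub, KUmap_of, KUmap_of, sub_eq_zero, hαq, MvN.map_mk _ _ _ hαp] at ha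
  obtain ⟨n, hn⟩ := P.exists_add_unitClass_eq B ha
  obtain ⟨N, hN⟩ := P.exists_limUnit_mul A p
  obtain ⟨N', hN'⟩ := P.exists_limUnit_mul E q
  -- The copy `e` of `1_n` is chosen over `E` and orthogonal to a unit dominating both `p` and `q`.
  -- One `e` then serves in `A_→` and in `B_→`, and `p + e` still lies exactly above `q + e`.
  obtain ⟨e, he, hee, ho⟩ := OrthCopies.exists_orth (P.limUnit E (max N N')) (P.limUnit E n)
    (P.isStarProjection_limUnit E _) (P.isStarProjection_limUnit E n)
  have heA := isStarProjection_map (P.limMap (StarAlgHom.ofId E A)) he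
  have hoq : q * e = 0 := by
    rw [← (hN' _ (le_max_right N N')).2, mul_assoc, ho, mul_zero]
  have hop : p * P.limMap (StarAlgHom.ofId E A) e = 0 := by
    rw [← (hN _ (le_max_left N N')).2, ← P.limMap_limUnit (StarAlgHom.ofId E A), mul_assoc,
      ← map_mul, ho, map_zero, mul_zero]
  have hAo : P.limMap (StarAlgHom.ofId E A) q * P.limMap (StarAlgHom.ofId E A) e = 0 := by
    rw [← map_mul, hoq, map_zero]
  have hA := P.mk_add_of_orth hp heA (P.mvnRel_ofId hee) hop
  have hA' := P.mk_add_of_orth hqA heA (P.mvnRel_ofId hee) hAo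
  have hB := P.mk_add_of_orth hαp (isStarProjection_map (P.limMap α) heA)
    (P.limMap_limUnit α n ▸ (P.mvnRel_ofId hee).map _)
    (by rw [← map_mul, hop, map_zero])
  have hB' := P.mk_add_of_orth hqB (isStarProjection_map (P.limMap (StarAlgHom.ofId E B)) he)
    (P.mvnRel_ofId hee) (by rw [← map_mul, hoq, map_zero])
  rw [← hB, ← hB', MvN.mk_eq, ← map_add, ← map_add] at hn
  rw [sub_eq_zero]
  refine of_eq_of_iff.2 ⟨P.unitClass A n, ?_⟩
  rw [← hA, ← hA', MvN.mk_eq, ← map_add]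
  refine P.mvnRel_of_pullback hα hlam hex (orth_add hp heA hop) ?_ hn
  rw [← limMap_comp, hψα, limMap_comp, map_add, hpq, limMap_ofId, ← map_add, limMap_ofId]

/-- Split excision, surjectivity: if `A` is the pullback of a split surjection `ψ : B → D` along
`E → D`, then the kernel of `K₀(A) → K₀(E)` maps onto the kernel of `K₀(B) → K₀(D)`. -/
theorem KUmap_pullback_surjective {α : A →⋆ₐ[E] B} {π : A →⋆ₐ[E] E} {ψ : B →⋆ₐ[E] D}
    {lam : D →⋆ₐ[E] B} (hα : Function.Injective α)
    (hD : Function.Injective (algebraMap E D))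
    (hψα : ψ.comp α = (StarAlgHom.ofId E D).comp π)
    (hlam : ψ.comp lam = StarAlgHom.id E D)
    (hex : ∀ b e, ψ b = algebraMap E D e → ∃ a, α a = b)
    {b : P.KU B} (hb : P.KUmap ψ b = 0) : ∃ a, P.KUmap π a = 0 ∧ P.KUmap α a = b := by
  obtain ⟨p, q, hp, hq, rfl, hpq⟩ := P.exists_eq_of_sub_of hlam hb
  obtain ⟨p, rfl⟩ := P.exists_limMap_eq hex hpq
  have hpA := isStarProjection_of_map _ (P.limMap_injective hα) hp
  have hqA := isStarProjection_map (P.limMap (StarAlgHom.ofId E A)) hq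
  -- The square determines `π p` only after mapping to `D_→`; injectivity of `E → D` recovers it in
  -- `E_→`.
  have hπp : P.limMap π p = P.limMap π (P.limMap (StarAlgHom.ofId E A) q) := by
    apply P.limMap_injective (φ := StarAlgHom.ofId E D) hD
    rw [← limMap_comp, ← hψα, limMap_comp, hpq, limMap_ofId, limMap_ofId]
  refine ⟨Algebra.GrothendieckAddGroup.of (MvN.mk p hpA) -
    Algebra.GrothendieckAddGroup.of (MvN.mk _ hqA), ?_, ?_⟩
  · rw [map_sub, KUmap_of, KUmap_of, sub_eq_zero,
      MvN.map_mk _ _ _ (isStarProjection_map (P.limMap π) hpA),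
      MvN.map_mk _ _ _ (isStarProjection_map (P.limMap π) hqA)]
    simp only [hπp]
  · rw [map_sub, KUmap_of, KUmap_of, MvN.map_mk _ _ _ hp,
      MvN.map_mk _ _ _ (isStarProjection_map (P.limMap α) hqA)]
    simp only [limMap_ofId]

end ProjSystem

end ProjK

/-! ### Split exact sequences and unitizations. -/

namespace ProjK

/-- Every `b` decomposes as `(b - s (g b)) + s (g b)`, with the first summand in `ker g`, the image
of `f`. -/
theorem IsSplitExact.exists_addEquiv {A B C : Type*} [AddCommGroup A] [AddCommGroup B]
    [AddCommGroup C] {f : A →+ B} {g : B →+ C} {s : C →+ B} (h : IsSplitExact f g s) :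
    ∃ e : A × C ≃+ B, ∀ a c, e (a, c) = f a + s c := by
  obtain ⟨hf, hfg, -, hs⟩ := h
  have hgf : ∀ a, g (f a) = 0 := fun a => (hfg _).2 ⟨a, rfl⟩
  refine ⟨AddEquiv.ofBijective (f.coprod s) ⟨?_, ?_⟩, fun a c => rfl⟩
  · rw [injective_iff_map_eq_zero]
    rintro ⟨a, c⟩ hac
    rw [AddMonoidHom.coprod_apply] at hac
    have hc : c = 0 := by simpa [hgf, hs] using congrArg g hac
    subst hc
    rw [map_zero, add_zero] at hac
    rw [(injective_iff_map_eq_zero f).1 hf a hac, Prod.mk_zero_zero]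
  · intro b
    obtain ⟨a, ha⟩ := (hfg (b - s (g b))).1 (by rw [map_sub, hs, sub_self])
    exact ⟨(a, g b), by rw [AddMonoidHom.coprod_apply, ha, sub_add_cancel]⟩

namespace ProjSystem

variable {E T : Type*} [CommRing E] [StarRing E] [Group T] (P : ProjSystem E T)
variable {F G H : Type*}
  [NonUnitalRing F] [StarRing F] [Module E F] [IsScalarTower E F F] [SMulCommClass E F F]
  [StarModule E F]
  [NonUnitalRing G] [StarRing G] [Module E G] [IsScalarTower E G G] [SMulCommClass E G G]
  [StarModule E G]
  [NonUnitalRing H] [StarRing H] [Module E H] [IsScalarTower E H H] [SMulCommClass E H H]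
  [StarModule E H]

theorem coe_K0map (φ : F →⋆ₙₐ[E] G) (a : P.K0 F) :
    (P.K0map φ a : P.KU (Unitization E G)) = P.KUmap (Unitization.starMap φ) a := rfl

/-- `K₀` maps split exact sequences to split exact sequences. -/
theorem isSplitExact_K0map {φ : F →⋆ₙₐ[E] G} {ψ : G →⋆ₙₐ[E] H} {lam : H →⋆ₙₐ[E] G}
    (h : IsSplitExact φ ψ lam) : IsSplitExact (P.K0map φ) (P.K0map ψ) (P.K0map lam) := by
  obtain ⟨hφ, hφψ, -, hψl⟩ := h
  have hlam : (Unitization.starMap ψ).comp (Unitization.starMap lam) =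
      StarAlgHom.id E (Unitization E H) := by
    rw [← Unitization.starMap_comp, ← Unitization.starMap_id]
    congr 1
    exact NonUnitalStarAlgHom.ext hψl
  have hα : Function.Injective (Unitization.starMap φ) := Unitization.starMap_injective hφ
  have hψα : (Unitization.starMap ψ).comp (Unitization.starMap φ) =
      (StarAlgHom.ofId E (Unitization E H)).comp (unitPi E F) := by
    apply StarAlgHom.ext
    intro x
    induction x using Unitization.ind with
    | inl_add_inr e x =>
      have : ψ (φ x) = 0 := (hφψ _).2 ⟨x, rfl⟩
      simp [this, unitPi_apply, Unitization.algebraMap_eq_inl]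
  -- The pullback property: if `(e', b)` maps into `E`, then `b ∈ ker ψ = im φ`.
  have hex : ∀ (b : Unitization E G) (e : E),
      Unitization.starMap ψ b = algebraMap E (Unitization E H) e →
        ∃ a, Unitization.starMap φ a = b := by
    intro b e hb
    induction b using Unitization.ind with
    | inl_add_inr e' b =>
      have hb0 : ψ b = 0 := by
        simpa [Unitization.algebraMap_eq_inl] using congrArg (fun x => x.snd) hb
      obtain ⟨x, rfl⟩ := (hφψ b).1 hb0
      exact ⟨Unitization.inl e' + Unitization.inr x, by simp [Unitization.algebraMap_eq_inl]⟩
  have hD : Function.Injective (algebraMap E (Unitization E H)) := Unitization.inl_injective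
  have hsec : ∀ c, P.K0map ψ (P.K0map lam c) = c := fun c =>
    Subtype.ext (P.KUmap_of_comp_eq_id hlam c.1)
  refine ⟨?_, ?_, fun c => ⟨_, hsec c⟩, hsec⟩
  · rw [injective_iff_map_eq_zero]
    intro a ha
    exact Subtype.ext (P.KUmap_pullback_injective hα hψα hlam hex a.2 (congrArg Subtype.val ha))
  · intro b
    constructor
    · intro hb
      obtain ⟨a, ha, hab⟩ := P.KUmap_pullback_surjective hα hD hψα hlam hex
        (congrArg Subtype.val hb)
      exact ⟨⟨a, ha⟩, Subtype.ext hab⟩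
    · rintro ⟨a, rfl⟩
      apply Subtype.ext
      have ha : P.KUmap (unitPi E F) a = 0 := a.2
      -- The composite on unitizations is not zero but factors through `π`, and `a` lies in the
      -- kernel of `K₀(π)`.
      rw [coe_K0map, coe_K0map, ← AddMonoidHom.comp_apply, ← KUmap_comp, hψα, KUmap_comp,
        AddMonoidHom.comp_apply, ha, map_zero]
      rfl

theorem exists_K0_addEquiv {φ : F →⋆ₙₐ[E] G} {ψ : G →⋆ₙₐ[E] H} {lam : H →⋆ₙₐ[E] G}
    (h : IsSplitExact φ ψ lam) :
    ∃ e : P.K0 F × P.K0 H ≃+ P.K0 G, ∀ a b, e (a, b) = P.K0map φ a + P.K0map lam b :=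
  (P.isSplitExact_K0map h).exists_addEquiv

/-- The split exact sequence `0 → F → E × F ⇄ E → 0`. -/
theorem isSplitExact_unitization (E F : Type*) [CommRing E] [StarRing E]
    [NonUnitalRing F] [StarRing F] [Module E F] [IsScalarTower E F F] [SMulCommClass E F F]
    [StarModule E F] :
    IsSplitExact (Unitization.inrNonUnitalStarAlgHom E F) (unitPi E F).toNonUnitalStarAlgHom
      (StarAlgHom.ofId E (Unitization E F)).toNonUnitalStarAlgHom := by
  refine ⟨Unitization.inr_injective, fun b => ⟨fun hb => ⟨b.snd, ?_⟩, ?_⟩,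
    fun e => ⟨Unitization.inl e, rfl⟩, fun e => rfl⟩
  · exact Unitization.ext (Eq.symm hb) rfl
  · rintro ⟨x, rfl⟩
    rfl

theorem nonempty_K0_unitization_addEquiv (F : Type*) [NonUnitalRing F] [StarRing F] [Module E F]
    [IsScalarTower E F F] [SMulCommClass E F F] [StarModule E F] :
    Nonempty (P.K0 (Unitization E F) ≃+ P.K0 E × P.K0 F) := by
  obtain ⟨e, -⟩ := P.exists_K0_addEquiv (F := F) (G := Unitization E F) (H := E)
    (isSplitExact_unitization E F)
  exact ⟨e.symm.trans AddEquiv.prodComm⟩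

/-- For the unital version of `K₀` no excision is needed: `K₀(F)` is by definition the kernel of
`K₀(π)`, and `E → E × F` splits `π`. -/
theorem nonempty_KU_unitization_addEquiv (F : Type*) [NonUnitalRing F] [StarRing F] [Module E F]
    [IsScalarTower E F F] [SMulCommClass E F F] [StarModule E F] :
    Nonempty (P.KU (Unitization E F) ≃+ P.KU E × P.K0 F) := by
  have hsec : ∀ c, P.KUmap (unitPi E F) (P.KUmap (StarAlgHom.ofId E (Unitization E F)) c) = c :=
    P.KUmap_of_comp_eq_id (StarAlgHom.ext fun e => AlgHomClass.commutes (unitPi E F) e)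
  have h : IsSplitExact (P.KUmap (unitPi E F)).ker.subtype (P.KUmap (unitPi E F))
      (P.KUmap (StarAlgHom.ofId E (Unitization E F))) :=
    ⟨Subtype.val_injective, fun b => ⟨fun hb => ⟨⟨b, hb⟩, rfl⟩, by rintro ⟨a, rfl⟩; exact a.2⟩,
      fun c => ⟨_, hsec c⟩, hsec⟩
  obtain ⟨e, -⟩ := h.exists_addEquiv
  exact ⟨e.symm.trans AddEquiv.prodComm⟩

end ProjSystem

end ProjK

theorem proposition936 {E T : Type*} [CommCStarAlgebra E] [Group T]
    (P : ProjK.ProjSystem E T) :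
    (∀ {F G H : Type*} [NonUnitalCStarAlgebra F] [NonUnitalCStarAlgebra G]
      [NonUnitalCStarAlgebra H] [Module E F] [Module E G] [Module E H]
      [ProjK.ECStarAlgebra E F] [ProjK.ECStarAlgebra E G] [ProjK.ECStarAlgebra E H]
      (φ : F →⋆ₙₐ[E] G) (ψ : G →⋆ₙₐ[E] H) (lam : H →⋆ₙₐ[E] G),
      ProjK.IsSplitExact φ ψ lam →
        ProjK.IsSplitExact (P.K0map φ) (P.K0map ψ) (P.K0map lam) ∧
        ∃ e : P.K0 F × P.K0 H ≃+ P.K0 G, ∀ a b, e (a, b) = P.K0map φ a + P.K0map lam b) ∧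
    (∀ (F : Type*) [NonUnitalCStarAlgebra F] [Module E F] [ProjK.ECStarAlgebra E F],
      Nonempty (P.K0 (Unitization E F) ≃+ P.K0 E × P.K0 F) ∧
      Nonempty (P.KU (Unitization E F) ≃+ P.KU E × P.K0 F)) := by
  refine ⟨fun φ ψ lam h => ?_, fun F => ?_⟩
  · exact ⟨P.isSplitExact_K0map h, P.exists_K0_addEquiv h⟩
  · exact ⟨P.nonempty_K0_unitization_addEquiv F, P.nonempty_KU_unitization_addEquiv F⟩
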